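/- \textbf{Setting.} Let $d\ge 1$, $T=[0,1]$, $\mathcal X=[0,1]^d$. Let $(\phi,\psi)$ and $(\tilde\phi,\tilde\psi)$ be father/mother wavelets of two orthonormal multiresolution analyses of $L^2(\mathbb R)$, compactly supported and respectively $\tau_1$ and $\tau_2$ times continuously differentiable. Write $h_{j,k}(x)=2^{j/2}h(2^jx-k)$ and $h^{\mathrm{per}}_{j,k}(x)=\sum_{z\in\mathbb Z}h_{j,k}(x+z)$. The time wavelets are $\tilde\psi_{-1,0}=\tilde\phi^{\mathrm{per}}_{0,0}$ and $\tilde\psi_{m,\ell}=\tilde\psi^{\mathrm{per}}_{m,\ell}$ for $m\ge 0$, $0\le\ell<2^m$. The space wavelets $\psi_\lambda$ are the periodic tensor-product wavelets: at level $|\lambda|=j\ge 0$ the products $\prod_{i=1}^d h^{(i)}_{j,k_i}(x_i)$ with $h^{(i)}\in\{\phi^{\mathrm{per}},\psi^{\mathrm{per}}\}$ not all equal to $\phi^{\mathrm{per}}$ and $0\le k_i<2^j$, and at level $|\lambda|=-1$ the single function $\prod_{i=1}^d\phi^{\mathrm{per}}_{0,0}(x_i)$. Let $\Lambda$ be the set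 of all $\lambda$. For $s_1,s_2>0$, $A_1,A_2>0$, and positive numbers $(A_\lambda)_{\lambda\in\Lambda}$ with $\sum_{\lambda}A_\lambda^2\le A_2^2$, let $\mathbf B^{s_1,s_2}_{p,q}(A_1,A_2)$ be the set of $f\in L^2(T\times\mathcal X)$, with $f(t,\cdot)\in L^2(\mathcal X)$ for every $t\in T$, such that $$\sup_{t\in T}\Big(\sum_{j\ge-1}2^{j(s_1+d(1/2-1/p_1))q_1}\Big(\sum_{|\lambda|=j}|\langle f(t,\cdot),\psi_\lambda\rangle|^{p_1}\Big)^{q_1/p_1}\Big)^{1/q_1}\le A_1$$ and, for every $\lambda\in\Lambda$, $$\Big(\sum_{m\ge-1}2^{m(s_2+1/2-1/p_2)q_2}\Big(\sum_{\ell}|\tilde\alpha_{\lambda,m,\ell}|^{p_2}\Big)^{q_2/p_2}\Big)^{1/q_2}\le A_\lambda,\qquad \tilde\alpha_{\lambda,m,\ell}=\int_{T\times\mathcal X}f(t,x)\,\tilde\psi_{m,\ell}(t)\psi_\lambda(x)\,dt\,dx,$$ with suprema in place of sums when an exponent is $\infty$. For $\epsilon>0$ one observes $\int g\,dY=\int gf+\epsilon\int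 g\,dW$ for all $g\in L^2(T\times\mathcal X)$, where $dW$ is a Gaussian white noise on $T\times\mathcal X$ (a centred Gaussian process indexed by $L^2(T\times\mathcal X)$ with covariance $\mathbb E[\int g_1dW\int g_2dW]=\int g_1g_2$). With $y_{\lambda,m,\ell}=\int\tilde\psi_{m,\ell}\psi_\lambda\,dY$, the linear wavelet projection estimator is $$\hat f_{j_1,m_2}(t,x)=\sum_{j=-1}^{j_1}\sum_{|\lambda|=j}\sum_{m=-1}^{m_2}\sum_{\ell}y_{\lambda,m,\ell}\,\tilde\psi_{m,\ell}(t)\psi_\lambda(x),$$ and its $L^2$-risk is $R(\hat f_{j_1,m_2},f)=\mathbb E\|\hat f_{j_1,m_2}-f\|^2_{L^2(T\times\mathcal X)}$. \textbf{Theorem.} Let $A_1,A_2>0$, $0<s_1<\tau_1$, $0<s_2<\tau_2$, $2\le p_1,q_1,p_2,q_2\le\infty$, and let $s>0$ be given by $\frac1s=\frac1{d+1}\big(\frac d{s_1}+\frac1{s_2}\big)$. Let the levels $j_1=j_1(\epsilon)$ and $m_2=m_2(\epsilon)$ be non-negative integers such that $$2^{j_1(\epsilon)+1}\asymp\epsilon^{-\frac{2s}{(2s+d+1)s_1}},\qquad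 2^{m_2(\epsilon)+1}\asymp\epsilon^{-\frac{2s}{(2s+d+1)s_2}},$$ meaning that each ratio of the two sides lies in $[\kappa^{-1},\kappa]$ for some fixed constant $\kappa\ge1$. Then there is a constant $C>0$, independent of $\epsilon$, of the radii $(A_\lambda)$ and of the choice of the levels (given $\kappa$), such that for all sufficiently small $\epsilon>0$ $$\sup_{f\in\mathbf B^{s_1,s_2}_{p,q}(A_1,A_2)}R(\hat f_{j_1(\epsilon),m_2(\epsilon)},f)\le C\,\epsilon^{\frac{4s}{2s+d+1}}.$$ -/

import Mathlib

open MeasureTheory ProbabilityTheory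
open scoped ENNReal

noncomputable section

namespace SpatioTemporal

/-! ### One-dimensional compactly supported orthonormal wavelets on the line -/

/-- The dilated and translated function `x ↦ 2 ^ (j / 2) * h (2 ^ j * x - k)`. -/
def dilate (h : ℝ → ℝ) (j : ℕ) (k : ℤ) (x : ℝ) : ℝ :=
  (2 : ℝ) ^ ((j : ℝ) / 2) * h ((2 : ℝ) ^ j * x - k)

theorem memLp_dilate {h : ℝ → ℝ} (hc : Continuous h) (hs : HasCompactSupport h)
    (j : ℕ) (k : ℤ) : MemLp (dilate h j k) 2 (volume : Measure ℝ) := by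
  have hs' : HasCompactSupport (fun x : ℝ => h ((2 : ℝ) ^ j * x - k)) := by
    have h2 : ((2 : ℝ) ^ j) ≠ 0 := by positivity
    exact hs.comp_homeomorph
      ((Homeomorph.mulLeft₀ ((2 : ℝ) ^ j) h2).trans (Homeomorph.subRight (k : ℝ)))
  have hc' : Continuous (dilate h j k) := by
    unfold dilate
    fun_prop
  exact hc'.memLp_of_hasCompactSupport (hs'.mul_left (f := fun _ => (2 : ℝ) ^ ((j : ℝ) / 2)))

/-- `dilate h j k` as an element of `L²(ℝ)`. -/
def dilateL2 (h : ℝ → ℝ) (hc : Continuous h) (hs : HasCompactSupport h) (j : ℕ) (k : ℤ) :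
    Lp ℝ 2 (volume : Measure ℝ) :=
  (memLp_dilate hc hs j k).toLp (dilate h j k)

/-- The closed linear span in `L²(ℝ)` of the functions `dilate h j k`, `k ∈ ℤ`. -/
def levelSpace (h : ℝ → ℝ) (hc : Continuous h) (hs : HasCompactSupport h) (j : ℕ) :
    Submodule ℝ (Lp ℝ 2 (volume : Measure ℝ)) :=
  (Submodule.span ℝ (Set.range (dilateL2 h hc hs j))).topologicalClosure

/-- A compactly supported orthonormal wavelet system on the line, of regularity `τ`: a father
wavelet `φ` and a mother wavelet `ψ`, compactly supported and `τ` times continuously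
differentiable, such that, with `V j` and `W j` the closed spans of the `φ_{j,k}` and of the
`ψ_{j,k}`, the spaces `V 0 ⊆ V 1 ⊆ …` increase to a dense subspace of `L²(ℝ)`, the `φ_{j,k}` form
an orthonormal basis of `V j`, and the `ψ_{j,k}` form an orthonormal basis of `W j`, which is the
orthogonal complement of `V j` in `V (j + 1)`. -/
structure WaveletSystem (τ : ℕ) where
  φ : ℝ → ℝ
  ψ : ℝ → ℝ
  contDiff_φ : ContDiff ℝ τ φ
  contDiff_ψ : ContDiff ℝ τ ψ
  compact_φ : HasCompactSupport φ
  compact_ψ : HasCompactSupport ψ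
  orthonormal_φ : ∀ j : ℕ, Orthonormal ℝ (dilateL2 φ contDiff_φ.continuous compact_φ j)
  orthonormal_ψ : ∀ j : ℕ, Orthonormal ℝ (dilateL2 ψ contDiff_ψ.continuous compact_ψ j)
  nested : ∀ j : ℕ, levelSpace φ contDiff_φ.continuous compact_φ j ≤
    levelSpace φ contDiff_φ.continuous compact_φ (j + 1)
  complement : ∀ j : ℕ, levelSpace ψ contDiff_ψ.continuous compact_ψ j =
    (levelSpace φ contDiff_φ.continuous compact_φ j)ᗮ ⊓
      levelSpace φ contDiff_φ.continuous compact_φ (j + 1)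
  dense : (⨆ j : ℕ, levelSpace φ contDiff_φ.continuous compact_φ j).topologicalClosure = ⊤

/-! ### Periodized wavelets and tensor products

The coarse level is `0`. The resolution level `j ∈ {-1, 0, 1, …}` is encoded by the natural number
`n = j + 1`. So `n = 0` is the level of the scaling function, and `n ≥ 1` is the level of the
wavelets at scale `n - 1`. As natural number subtraction truncates, `n - 1 = 0` for `n = 0`, which is
the scale of the scaling function. -/

/-- The `1`-periodic version `x ↦ ∑_z h_{j,k} (x + z)` of `dilate h j k`; the sum over `z ∈ ℤ`
has only finitely many nonzero terms when `h` has compact support. -/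
def periodized (h : ℝ → ℝ) (j : ℕ) (k : ℤ) (x : ℝ) : ℝ :=
  ∑' z : ℤ, dilate h j k (x + z)

/-- Positions `ℓ` of the time wavelets at encoded level `n`. -/
abbrev TimeIdx (n : ℕ) : Type := Fin (2 ^ (n - 1))

/-- The periodic wavelets in time (for `n = 0`, the periodic scaling function). -/
def timeWavelet {τ : ℕ} (S : WaveletSystem τ) (n : ℕ) (l : TimeIdx n) (t : ℝ) : ℝ :=
  periodized (if n = 0 then S.φ else S.ψ) (n - 1) ((l : ℕ) : ℤ) t

/-- Indices `λ` of the `d`-dimensional wavelets at encoded level `n`: an orientation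
`e ∈ {0,1}^d`, which is `0` for the scaling function (`n = 0`) and nonzero for the wavelets
(`n ≥ 1`), and a position. -/
abbrev SpaceIdx (d n : ℕ) : Type :=
  {e : Fin d → Bool // (e = fun _ => false) ↔ n = 0} × (Fin d → Fin (2 ^ (n - 1)))

/-- The periodic tensor-product wavelets in space: in the coordinate `i` the factor is the mother
wavelet if `e i = true`, and the father wavelet otherwise. -/
def spaceWavelet {τ : ℕ} (S : WaveletSystem τ) {d : ℕ} (n : ℕ) (idx : SpaceIdx d n)
    (x : Fin d → ℝ) : ℝ :=
  ∏ i, periodized (if idx.1.1 i = true then S.ψ else S.φ) (n - 1) ((idx.2 i : ℕ) : ℤ) (x i)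

/-! ### Domains and Besov-type balls -/

/-- Lebesgue measure on `T = [0,1]`. -/
def timeMeasure : Measure ℝ := volume.restrict (Set.Icc 0 1)

/-- Lebesgue measure on `X = [0,1]^d`. -/
def spaceMeasure (d : ℕ) : Measure (Fin d → ℝ) := volume.restrict (Set.Icc 0 1)

/-- Lebesgue measure on `T × X`. -/
def stMeasure (d : ℕ) : Measure (ℝ × (Fin d → ℝ)) := timeMeasure.prod (spaceMeasure d)

/-- The `ℓ^p` norm, `1 ≤ p ≤ ∞`, of a family of real numbers, with values in `[0,∞]`. -/
def ellNorm (p : ℝ≥0∞) {ι : Type} (a : ι → ℝ≥0∞) : ℝ≥0∞ :=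
  if p = ∞ then ⨆ i, a i else (∑' i, a i ^ p.toReal) ^ (1 / p.toReal)

/-- The Besov sequence norm in dimension `δ` of a family of coefficients,
`(∑_{j ≥ -1} 2 ^ (j (s + δ (1/2 - 1/p)) q) (∑_{|i| = j} |a_i| ^ p) ^ (q/p)) ^ (1/q)`, with suprema
in place of sums when `p = ∞` or `q = ∞`; here `j = n - 1`. -/
def besovNorm (δ : ℕ) (s : ℝ) (p q : ℝ≥0∞) {ι : ℕ → Type} (a : (n : ℕ) → ι n → ℝ) : ℝ≥0∞ :=
  ellNorm q fun n : ℕ =>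
    ENNReal.ofReal ((2 : ℝ) ^ (((n : ℝ) - 1) * (s + δ * (1 / 2 - (p⁻¹).toReal)))) *
      ellNorm p fun i : ι n => ‖a n i‖ₑ

/-- The coefficients `⟨g, ψ_λ⟩` of a function `g` on `X`. -/
def spaceCoeff {τ : ℕ} (S : WaveletSystem τ) {d : ℕ} (g : (Fin d → ℝ) → ℝ)
    (n : ℕ) (idx : SpaceIdx d n) : ℝ :=
  ∫ x, g x * spaceWavelet S n idx x ∂(spaceMeasure d)

/-- The function `(t, x) ↦ ψ̃_{m,ℓ}(t) ψ_λ(x)` on `T × X`. -/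
def stWavelet {τ₁ τ₂ : ℕ} (S₁ : WaveletSystem τ₁) (S₂ : WaveletSystem τ₂) {d : ℕ}
    (n : ℕ) (idx : SpaceIdx d n) (m : ℕ) (l : TimeIdx m) (z : ℝ × (Fin d → ℝ)) : ℝ :=
  timeWavelet S₂ m l z.1 * spaceWavelet S₁ n idx z.2

/-- The coefficients of a function on `T × X` with respect to the functions `stWavelet`. -/
def stCoeff {τ₁ τ₂ : ℕ} (S₁ : WaveletSystem τ₁) (S₂ : WaveletSystem τ₂) {d : ℕ}
    (f : ℝ → (Fin d → ℝ) → ℝ) (n : ℕ) (idx : SpaceIdx d n) (m : ℕ) (l : TimeIdx m) : ℝ :=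
  ∫ z, f z.1 z.2 * stWavelet S₁ S₂ n idx m l z ∂(stMeasure d)

/-- Admissible radii: positive numbers `A_λ` with `∑_λ A_λ² ≤ A₂²`. -/
def AdmissibleRadii {d : ℕ} (A₂ : ℝ) (Arad : (n : ℕ) → SpaceIdx d n → ℝ) : Prop :=
  (∀ n idx, 0 < Arad n idx) ∧
    (∑' n : ℕ, ∑ idx : SpaceIdx d n, ENNReal.ofReal (Arad n idx ^ 2)) ≤ ENNReal.ofReal (A₂ ^ 2)

/-- The ball of functions `f ∈ L²(T × X)`, with `f(t, ·) ∈ L²(X)` for each `t ∈ T`, such that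
`sup_{t ∈ T} ‖f(t, ·)‖^{s₁}_{p₁,q₁} ≤ A₁` and `‖α_λ‖^{s₂}_{p₂,q₂} ≤ A_λ` for all `λ`. -/
def stBall {τ₁ τ₂ : ℕ} (S₁ : WaveletSystem τ₁) (S₂ : WaveletSystem τ₂) (d : ℕ)
    (s₁ s₂ : ℝ) (p₁ q₁ p₂ q₂ : ℝ≥0∞) (A₁ : ℝ) (Arad : (n : ℕ) → SpaceIdx d n → ℝ) :
    Set (ℝ → (Fin d → ℝ) → ℝ) :=
  {f | MemLp (fun z : ℝ × (Fin d → ℝ) => f z.1 z.2) 2 (stMeasure d) ∧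
    (∀ t ∈ Set.Icc (0 : ℝ) 1, MemLp (f t) 2 (spaceMeasure d)) ∧
    (⨆ t ∈ Set.Icc (0 : ℝ) 1, besovNorm d s₁ p₁ q₁ (spaceCoeff S₁ (f t))) ≤ ENNReal.ofReal A₁ ∧
    ∀ (n : ℕ) (idx : SpaceIdx d n),
      besovNorm 1 s₂ p₂ q₂ (stCoeff S₁ S₂ f n idx) ≤ ENNReal.ofReal (Arad n idx)}

/-! ### White noise, observations, estimator and risk -/

/-- A Gaussian white noise on `T × X`: a centered Gaussian process `g ↦ W g = ∫ g dW`, indexed by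
the square-integrable functions `g` on `T × X`, with `E (W g₁ W g₂) = ∫ g₁ g₂`. (The value of `W`
at a function that is not square-integrable is irrelevant.) -/
structure IsWhiteNoise {d : ℕ} {Ω : Type*} [MeasurableSpace Ω] (P : Measure Ω)
    (W : (ℝ × (Fin d → ℝ) → ℝ) → Ω → ℝ) : Prop where
  gaussian : IsGaussianProcess
    (fun g : {g : ℝ × (Fin d → ℝ) → ℝ // MemLp g 2 (stMeasure d)} => W g.1) P
  mean_zero : ∀ g, MemLp g 2 (stMeasure d) → ∫ ω, W g ω ∂P = 0
  covariance : ∀ g₁ g₂, MemLp g₁ 2 (stMeasure d) → MemLp g₂ 2 (stMeasure d) →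
    ∫ ω, W g₁ ω * W g₂ ω ∂P = ∫ z, g₁ z * g₂ z ∂(stMeasure d)

/-- The observation `∫ g dY = ∫ g f + ε ∫ g dW` in the model `dY = f + ε dW`. -/
def observation {d : ℕ} {Ω : Type*} (W : (ℝ × (Fin d → ℝ) → ℝ) → Ω → ℝ) (ε : ℝ)
    (f : ℝ → (Fin d → ℝ) → ℝ) (g : ℝ × (Fin d → ℝ) → ℝ) (ω : Ω) : ℝ :=
  (∫ z, g z * f z.1 z.2 ∂(stMeasure d)) + ε * W g ω

/-- The wavelet projection estimator computed from the data `Y`, `Y g = ∫ g dY`: it keeps the space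
levels `-1, …, j₁` and the time levels `-1, …, m₂`. -/
def linearEstimator {τ₁ τ₂ : ℕ} (S₁ : WaveletSystem τ₁) (S₂ : WaveletSystem τ₂) {d : ℕ}
    (j₁ m₂ : ℕ) (Y : (ℝ × (Fin d → ℝ) → ℝ) → ℝ) (z : ℝ × (Fin d → ℝ)) : ℝ :=
  ∑ n ∈ Finset.range (j₁ + 2), ∑ idx : SpaceIdx d n, ∑ m ∈ Finset.range (m₂ + 2),
    ∑ l : TimeIdx m, Y (stWavelet S₁ S₂ n idx m l) * stWavelet S₁ S₂ n idx m l z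

/-- The `L²`-risk `E ‖f̂ - f‖²` of the wavelet projection estimator, with values in `[0,∞]`. -/
def linearRisk {τ₁ τ₂ : ℕ} (S₁ : WaveletSystem τ₁) (S₂ : WaveletSystem τ₂) {d : ℕ}
    {Ω : Type*} [MeasurableSpace Ω] (P : Measure Ω) (W : (ℝ × (Fin d → ℝ) → ℝ) → Ω → ℝ)
    (ε : ℝ) (j₁ m₂ : ℕ) (f : ℝ → (Fin d → ℝ) → ℝ) : ℝ≥0∞ :=
  ∫⁻ ω, ∫⁻ z, ENNReal.ofReal
    ((linearEstimator S₁ S₂ j₁ m₂ (fun g => observation W ε f g ω) z - f z.1 z.2) ^ 2)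
      ∂(stMeasure d) ∂P

end SpatioTemporal

end

namespace SpatioTemporal

/-! ### Families of functions that are orthonormal bases of `L²` -/

section L2

variable {α β ι κ : Type*} [MeasurableSpace α] [MeasurableSpace β] {μ : Measure α} {ν : Measure β}

/-! The products `stWavelet` form an orthonormal basis of `L²(T × X)` (`isL2Basis_stWavelet`). By
Parseval the risk is therefore exactly `ε²` times the number of kept indices plus the sum of the
squared coefficients left out (`linearRisk_eq`).

A coefficient left out lies beyond the space cutoff or beyond the time cutoff. For `p ≥ 2`, Hölder's
inequality turns a Besov bound into geometric decay `2 ^ (-2js)` of the energy per level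
(`sum_sq_le_of_besovNorm_le`). The space tail is treated for each fixed `t`, after Parseval in time;
the time tail is treated for each `λ` and summed with `∑ A_λ² ≤ A₂²`. With `v = 2s/(2s+d+1)`, the
levels give `2 ^ j₁ ≍ ε ^ (-v/s₁)` and `2 ^ m₂ ≍ ε ^ (-v/s₂)`, so both tails are of order `ε ^
(2v)`; the relation defining `s` gives the variance the same order.

The basis property is the longer half. Orthonormality descends from the line by unfolding the
periodization (`integral_tsum_mul_tsum`). For totality, compact support makes an interior piece of
`f` see only scaling functions supported in `(0,1)` at fine scales, and these agree on `[0,1]` with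
their periodizations (`setIntegral_sq_eq_zero`). Finite two-scale relations then carry totality over
to the wavelets, and Fubini carries it to products. -/

theorem inner_toLp {f g : α → ℝ} (hf : MemLp f 2 μ) (hg : MemLp g 2 μ) :
    inner ℝ (hf.toLp f) (hg.toLp g) = ∫ x, f x * g x ∂μ := by
  rw [L2.inner_def]
  refine integral_congr_ae ?_
  filter_upwards [hf.coeFn_toLp, hg.coeFn_toLp] with x h1 h2
  simp [h1, h2, mul_comm]

theorem integrable_mul_of_memLp {f g : α → ℝ} (hf : MemLp f 2 μ) (hg : MemLp g 2 μ) :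
    Integrable (fun x => f x * g x) μ :=
  MemLp.integrable_mul hf hg

theorem sq_integral_mul_le {f g : α → ℝ} (hf : MemLp f 2 μ) (hg : MemLp g 2 μ) :
    (∫ x, f x * g x ∂μ) ^ 2 ≤ (∫ x, f x ^ 2 ∂μ) * ∫ x, g x ^ 2 ∂μ := by
  have h := real_inner_mul_inner_self_le (hf.toLp f) (hg.toLp g)
  rw [inner_toLp, inner_toLp, inner_toLp] at h
  simpa only [sq] using h

/-- A family of functions such that a square-integrable function orthogonal to all of its members
vanishes almost everywhere. -/
def IsTotal (μ : Measure α) (e : ι → α → ℝ) : Prop :=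
  ∀ f : α → ℝ, MemLp f 2 μ → (∀ i, ∫ x, f x * e i x ∂μ = 0) → f =ᵐ[μ] 0

/-- A family of functions that is an orthonormal basis of `L²(μ)`. -/
structure IsL2Basis (μ : Measure α) (e : ι → α → ℝ) : Prop where
  memLp : ∀ i, MemLp (e i) 2 μ
  integral_sq : ∀ i, ∫ x, e i x * e i x ∂μ = 1
  integral_mul : ∀ i j, i ≠ j → ∫ x, e i x * e j x ∂μ = 0
  total : IsTotal μ e

theorem orthonormal_toLp {e : ι → α → ℝ} (hm : ∀ i, MemLp (e i) 2 μ)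
    (h1 : ∀ i, ∫ x, e i x * e i x ∂μ = 1) (h0 : ∀ i j, i ≠ j → ∫ x, e i x * e j x ∂μ = 0) :
    Orthonormal ℝ fun i => (hm i).toLp (e i) := by
  refine ⟨fun i => ?_, fun i j hij => ?_⟩
  · have h : ‖(hm i).toLp (e i)‖ ^ 2 = 1 := by
      rw [← real_inner_self_eq_norm_sq, inner_toLp, h1]
    exact (pow_eq_one_iff_of_nonneg (norm_nonneg _) two_ne_zero).1 h
  · simpa [inner_toLp] using h0 i j hij

/-- Totality says that the span has trivial orthogonal complement, so the classes form a Hilbert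
basis and Parseval applies. -/
theorem IsL2Basis.hasSum_sq {e : ι → α → ℝ} (h : IsL2Basis μ e) {f : α → ℝ} (hf : MemLp f 2 μ) :
    HasSum (fun i => (∫ x, f x * e i x ∂μ) ^ 2) (∫ x, f x ^ 2 ∂μ) := by
  have ho := orthonormal_toLp h.memLp h.integral_sq h.integral_mul
  have hbot : (Submodule.span ℝ (Set.range fun i => (h.memLp i).toLp (e i)))ᗮ = ⊥ := by
    rw [Submodule.eq_bot_iff]
    intro x hx
    have hx' := h.total x (Lp.memLp x) fun i => by
      have h1 := (Submodule.mem_orthogonal _ _).1 hx _ (Submodule.subset_span ⟨i, rfl⟩)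
      have h2 := inner_toLp (h.memLp i) (Lp.memLp x)
      rw [Lp.toLp_coeFn, h1] at h2
      simpa only [mul_comm] using h2.symm
    exact (Lp.eq_zero_iff_ae_eq_zero).2 hx'
  have hb := (HilbertBasis.mkOfOrthogonalEqBot ho hbot).hasSum_inner_mul_inner
    (hf.toLp f) (hf.toLp f)
  simp only [HilbertBasis.coe_mkOfOrthogonalEqBot, inner_toLp] at hb
  simpa only [sq, mul_comm (f _)] using hb

theorem IsL2Basis.lintegral_sq {e : ι → α → ℝ} (h : IsL2Basis μ e) {f : α → ℝ}
    (hf : MemLp f 2 μ) :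
    ∫⁻ x, ENNReal.ofReal (f x ^ 2) ∂μ = ∑' i, ENNReal.ofReal ((∫ x, f x * e i x ∂μ) ^ 2) := by
  have hs := h.hasSum_sq hf
  rw [← ofReal_integral_eq_lintegral_ofReal hf.integrable_sq (ae_of_all _ fun x => sq_nonneg _),
    ← hs.tsum_eq, ENNReal.ofReal_tsum_of_nonneg (fun i => sq_nonneg _) hs.summable]

/-- Cauchy–Schwarz on each slice bounds the square by the slice energy of `f` times that of `g`, and
the slice energy is integrable by Fubini. -/
theorem memLp_integral_mul [SFinite μ] [SFinite ν] {f : α × β → ℝ} {g : β → ℝ}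
    (hf : MemLp f 2 (μ.prod ν)) (hg : MemLp g 2 ν) :
    MemLp (fun x => ∫ y, f (x, y) * g y ∂ν) 2 μ := by
  have hm : AEStronglyMeasurable (fun x => ∫ y, f (x, y) * g y ∂ν) μ :=
    (hf.aestronglyMeasurable.mul hg.aestronglyMeasurable.comp_snd).integral_prod_right'
  rw [memLp_two_iff_integrable_sq hm]
  have hfi := hf.integrable_sq
  refine (hfi.integral_prod_left.mul_const (∫ y, g y ^ 2 ∂ν)).mono' (hm.pow 2) ?_
  filter_upwards [hfi.prod_right_ae, hf.aestronglyMeasurable.prodMk_left] with x hx hxm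
  rw [Real.norm_of_nonneg (sq_nonneg _)]
  exact sq_integral_mul_le ((memLp_two_iff_integrable_sq hxm).2 hx) hg

theorem integral_mul_prod_mul [SFinite μ] [SFinite ν] {f : α × β → ℝ} {u : α → ℝ} {v : β → ℝ}
    (hf : Integrable (fun z : α × β => f z * (u z.1 * v z.2)) (μ.prod ν)) :
    ∫ z, f z * (u z.1 * v z.2) ∂(μ.prod ν) = ∫ x, (∫ y, f (x, y) * v y ∂ν) * u x ∂μ := by
  rw [integral_prod _ hf]
  refine integral_congr_ae (ae_of_all _ fun x => ?_)
  simp only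
  rw [← integral_mul_const]
  refine integral_congr_ae (ae_of_all _ fun y => ?_)
  simp only
  ring

theorem memLp_prod_mul [SFinite μ] [SFinite ν] {u : α → ℝ} {v : β → ℝ}
    (hu : MemLp u 2 μ) (hv : MemLp v 2 ν) :
    MemLp (fun z : α × β => u z.1 * v z.2) 2 (μ.prod ν) := by
  have hm : AEStronglyMeasurable (fun z : α × β => u z.1 * v z.2) (μ.prod ν) :=
    hu.aestronglyMeasurable.comp_fst.mul hv.aestronglyMeasurable.comp_snd
  rw [memLp_two_iff_integrable_sq hm]
  simpa only [mul_pow] using hu.integrable_sq.mul_prod hv.integrable_sq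

/-- For each `j`, the coefficient of the slices against `e' j` is an `L²` function of `x` orthogonal
to every `e i`, hence null. Countability of `κ` gives one exceptional null set for all `j`, outside
of which the slice itself is null. -/
theorem IsTotal.prod [SFinite μ] [SFinite ν] [Countable κ] {e : ι → α → ℝ} {e' : κ → β → ℝ}
    (h : IsTotal μ e) (h' : IsTotal ν e') (hm : ∀ i, MemLp (e i) 2 μ)
    (hm' : ∀ i, MemLp (e' i) 2 ν) :
    IsTotal (μ.prod ν) fun (i : ι × κ) (z : α × β) => e i.1 z.1 * e' i.2 z.2 := by
  intro f hf hz
  have h1 : ∀ᵐ x ∂μ, ∀ j, ∫ y, f (x, y) * e' j y ∂ν = 0 := by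
    rw [ae_all_iff]
    intro j
    refine h _ (memLp_integral_mul hf (hm' j)) fun i => ?_
    rw [← integral_mul_prod_mul]
    · exact hz (i, j)
    · exact integrable_mul_of_memLp hf (memLp_prod_mul (hm i) (hm' j))
  have h2 : ∀ᵐ x ∂μ, ∀ᵐ y ∂ν, f (x, y) = 0 := by
    filter_upwards [h1, hf.integrable_sq.prod_right_ae, hf.aestronglyMeasurable.prodMk_left]
      with x hx hxi hxm
    exact h' _ ((memLp_two_iff_integrable_sq hxm).2 hxi) hx
  -- Returning from slices to the product needs a measurable zero set, hence the strongly measurable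
  -- representative.
  have h3 : ∀ᵐ z ∂(μ.prod ν), hf.aestronglyMeasurable.mk f z = 0 := by
    refine (Measure.ae_prod_iff_ae_ae ?_).2 ?_
    · exact (hf.aestronglyMeasurable.stronglyMeasurable_mk.measurable) (measurableSet_singleton 0)
    · filter_upwards [h2, Measure.ae_ae_of_ae_prod hf.aestronglyMeasurable.ae_eq_mk] with x h4 h5
      filter_upwards [h4, h5] with y h6 h7
      rw [← h7, h6]
  filter_upwards [h3, hf.aestronglyMeasurable.ae_eq_mk] with z h4 h5
  rw [h5, h4, Pi.zero_apply]

theorem IsL2Basis.prod [SFinite μ] [SFinite ν] [Countable κ] {e : ι → α → ℝ} {e' : κ → β → ℝ}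
    (h : IsL2Basis μ e) (h' : IsL2Basis ν e') :
    IsL2Basis (μ.prod ν) fun (i : ι × κ) (z : α × β) => e i.1 z.1 * e' i.2 z.2 := by
  have key : ∀ i j : ι × κ,
      ∫ z : α × β, (e i.1 z.1 * e' i.2 z.2) * (e j.1 z.1 * e' j.2 z.2) ∂(μ.prod ν) =
        (∫ x, e i.1 x * e j.1 x ∂μ) * ∫ y, e' i.2 y * e' j.2 y ∂ν := by
    intro i j
    rw [← integral_prod_mul]
    refine integral_congr_ae (ae_of_all _ fun z => ?_)
    simp only
    ring
  refine ⟨fun i => memLp_prod_mul (h.memLp _) (h'.memLp _), fun i => ?_, fun i j hij => ?_,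
    h.total.prod h'.total h.memLp h'.memLp⟩
  · rw [key, h.integral_sq, h'.integral_sq, one_mul]
  · rw [key]
    by_cases h1 : i.1 = j.1
    · rw [h'.integral_mul _ _ fun h2 => hij (Prod.ext h1 h2), mul_zero]
    · rw [h.integral_mul _ _ h1, zero_mul]

theorem memLp_pi_prod [SigmaFinite μ] {u : ι → α → ℝ} (hu : ∀ i, MemLp (u i) 2 μ) (d : ℕ)
    (i : Fin d → ι) :
    MemLp (fun x : Fin d → α => ∏ a, u (i a) (x a)) 2 (Measure.pi fun _ : Fin d => μ) := by
  have hm : AEStronglyMeasurable (fun x : Fin d → α => ∏ a, u (i a) (x a))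
      (Measure.pi fun _ : Fin d => μ) := by
    refine Finset.aestronglyMeasurable_fun_prod _ fun a _ => ?_
    exact (hu (i a)).aestronglyMeasurable.comp_quasiMeasurePreserving
      (Measure.quasiMeasurePreserving_eval _ a)
  rw [memLp_two_iff_integrable_sq hm]
  simp only [← Finset.prod_pow]
  exact Integrable.fintype_prod fun a => (hu (i a)).integrable_sq

/-- Induction on the dimension, splitting off the first coordinate. In dimension `0` the measure is
a point mass and the empty product is `1`. -/
theorem IsTotal.pi [SigmaFinite μ] [Countable ι] {e : ι → α → ℝ} (h : IsTotal μ e)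
    (hm : ∀ i, MemLp (e i) 2 μ) (d : ℕ) :
    IsTotal (Measure.pi fun _ : Fin d => μ)
      fun (i : Fin d → ι) (x : Fin d → α) => ∏ a, e (i a) (x a) := by
  induction d with
  | zero =>
    intro f hf hz
    have h0 := hz isEmptyElim
    rw [Measure.pi_of_empty] at h0 ⊢
    have h1 : ∀ x : Fin 0 → α, f x = 0 := by
      intro x
      simp only [Finset.univ_eq_empty, Finset.prod_empty, mul_one] at h0
      rw [integral_dirac] at h0
      rw [← h0]
      congr 1
      exact Subsingleton.elim _ _
    exact ae_of_all _ h1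
  | succ d ih =>
    intro f hf hz
    have hmp := measurePreserving_piFinSuccAbove (fun _ : Fin (d + 1) => μ) 0
    have hmp' := hmp.symm
    have ht := h.prod ih hm (memLp_pi_prod hm d)
    have hg := ht (f ∘ (MeasurableEquiv.piFinSuccAbove (fun _ : Fin (d + 1) => α) 0).symm)
      (hf.comp_measurePreserving hmp') fun i => by
        have h1 := hz (Fin.cons i.1 i.2)
        rw [← hmp'.integral_comp (MeasurableEquiv.measurableEmbedding _)] at h1
        rw [← h1]
        refine integral_congr_ae (ae_of_all _ fun z => ?_)
        simp [Fin.prod_univ_succ, MeasurableEquiv.piFinSuccAbove]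
    have hg' := hmp.quasiMeasurePreserving.ae hg
    filter_upwards [hg'] with x hx
    rwa [Function.comp_apply, MeasurableEquiv.symm_apply_apply] at hx

end L2

/-! ### Periodization -/

theorem continuous_dilate {h : ℝ → ℝ} (hc : Continuous h) (j : ℕ) (k : ℤ) :
    Continuous (dilate h j k) := by
  unfold dilate
  fun_prop

theorem hasCompactSupport_dilate {h : ℝ → ℝ} (hs : HasCompactSupport h) (j : ℕ) (k : ℤ) :
    HasCompactSupport (dilate h j k) := by
  have hs' : HasCompactSupport (fun x : ℝ => h ((2 : ℝ) ^ j * x - k)) := by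
    have h2 : ((2 : ℝ) ^ j) ≠ 0 := by positivity
    exact hs.comp_homeomorph
      ((Homeomorph.mulLeft₀ ((2 : ℝ) ^ j) h2).trans (Homeomorph.subRight (k : ℝ)))
  exact hs'.mul_left (f := fun _ => (2 : ℝ) ^ ((j : ℝ) / 2))

theorem dilate_add_int (h : ℝ → ℝ) (j : ℕ) (k z : ℤ) (x : ℝ) :
    dilate h j k (x + z) = dilate h j (k - 2 ^ j * z) x := by
  unfold dilate
  congr 2
  push_cast
  ring

section Periodization

variable {a b : ℝ → ℝ}

/-- The finite set is uniform over bounded `x`, so periodizing sums are locally finite sums of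
functions. -/
theorem exists_finset_int_of_bounded (ha : HasCompactSupport a) (R : ℝ) :
    ∃ s : Finset ℤ, ∀ x : ℝ, |x| ≤ R → ∀ z : ℤ, z ∉ s → a (x + z) = 0 := by
  obtain ⟨M, hM, h⟩ := ha.exists_pos_le_norm
  refine ⟨Finset.Icc (-⌈R + M⌉) ⌈R + M⌉, fun x hx z hz => h _ ?_⟩
  rw [Real.norm_eq_abs]
  by_contra! hlt
  apply hz
  have h1 : |(z : ℝ)| ≤ R + M := by
    have : (z : ℝ) = (x + z) - x := by ring
    rw [this]
    exact (abs_sub _ _).trans (by linarith)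
  have h2 := h1.trans (Int.le_ceil (R + M))
  rw [abs_le] at h2
  rw [Finset.mem_Icc]
  exact ⟨by exact_mod_cast h2.1, by exact_mod_cast h2.2⟩

theorem summable_comp_add_int (ha : HasCompactSupport a) (x : ℝ) :
    Summable fun z : ℤ => a (x + z) := by
  obtain ⟨s, hs⟩ := exists_finset_int_of_bounded ha |x|
  exact summable_of_ne_finset_zero fun z hz => hs x le_rfl z hz

theorem continuous_tsum_comp_add_int (hc : Continuous a) (ha : HasCompactSupport a) :
    Continuous fun x : ℝ => ∑' z : ℤ, a (x + z) := by
  rw [continuous_iff_continuousAt]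
  intro x
  obtain ⟨s, hs⟩ := exists_finset_int_of_bounded ha (|x| + 1)
  have h1 : ContinuousAt (fun y : ℝ => ∑ z ∈ s, a (y + z)) x := by fun_prop
  refine h1.congr ?_
  filter_upwards [Metric.ball_mem_nhds x one_pos] with y hy
  refine (tsum_eq_sum fun z hz => hs y ?_ z hz).symm
  rw [Metric.mem_ball, Real.dist_eq] at hy
  have : y = (y - x) + x := by ring
  rw [this]
  exact (abs_add_le _ _).trans (by linarith)

theorem tsum_comp_add_int_add_int (a : ℝ → ℝ) (x : ℝ) (n : ℤ) :
    ∑' z : ℤ, a (x + n + z) = ∑' z : ℤ, a (x + z) := by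
  rw [← (Equiv.addLeft n).tsum_eq fun z : ℤ => a (x + z)]
  refine tsum_congr fun z => ?_
  simp [add_assoc]

/-- Unfolding: `b` is periodic, so the terms are integrals of `a * b` over the translates of
`[0,1]`, which tile the line. -/
theorem integral_tsum_mul_of_periodic (hc : Continuous a) (ha : HasCompactSupport a)
    (hb : Continuous b) (hp : ∀ (x : ℝ) (n : ℤ), b (x + n) = b x) :
    ∫ x, (∑' z : ℤ, a (x + z)) * b x ∂timeMeasure = ∫ x, a x * b x := by
  obtain ⟨s, hs⟩ := exists_finset_int_of_bounded ha 1
  have hi : Integrable fun x => a x * b x :=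
    (hc.mul hb).integrable_of_hasCompactSupport (ha.mul_right (f' := b))
  have h0 : ∀ x ∈ Set.uIcc (0 : ℝ) 1, |x| ≤ 1 := by
    intro x hx
    rw [Set.uIcc_of_le zero_le_one] at hx
    exact abs_le.2 ⟨by linarith [hx.1], hx.2⟩
  have h1 := hi.hasSum_intervalIntegral_comp_add_int.tsum_eq
  rw [tsum_eq_sum (s := s)] at h1
  · rw [← h1, timeMeasure, integral_Icc_eq_integral_Ioc,
      ← intervalIntegral.integral_of_le zero_le_one, ← intervalIntegral.integral_finsetSum]
    · refine intervalIntegral.integral_congr fun x hx => ?_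
      simp only [hp]
      rw [tsum_eq_sum fun z hz => hs x (h0 x hx) z hz, Finset.sum_mul]
    · intro z _
      exact Continuous.intervalIntegrable (by fun_prop) _ _
  · intro z hz
    refine intervalIntegral.integral_zero_ae (ae_of_all _ fun x hx => ?_)
    rw [hs x (h0 x (Set.uIoc_subset_uIcc hx)) z hz, zero_mul]

theorem integral_mul_tsum (hca : Continuous a) (ha : HasCompactSupport a)
    (hcb : Continuous b) (hb : HasCompactSupport b)
    (h : ∀ z : ℤ, z ≠ 0 → ∫ x, a x * b (x + z) = 0) :
    ∫ x, a x * ∑' z : ℤ, b (x + z) = ∫ x, a x * b x := by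
  obtain ⟨M, hM, hMa⟩ := ha.exists_pos_le_norm
  obtain ⟨s, hs⟩ := exists_finset_int_of_bounded hb M
  have h1 : ∀ x, a x * ∑' z : ℤ, b (x + z) = ∑ z ∈ insert 0 s, a x * b (x + z) := by
    intro x
    rcases le_total M |x| with hx | hx
    · rw [← Finset.mul_sum, hMa x hx, zero_mul, zero_mul]
    · rw [tsum_eq_sum fun z hz => hs x hx z fun hz' => hz (Finset.mem_insert_of_mem hz'),
        Finset.mul_sum]
  simp only [h1]
  rw [integral_finsetSum, Finset.sum_eq_single (0 : ℤ)]
  · simp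
  · exact fun z _ hz => h z hz
  · exact fun hz => absurd (Finset.mem_insert_self _ _) hz
  · intro z _
    exact (Continuous.mul hca (by fun_prop)).integrable_of_hasCompactSupport ha.mul_right

theorem integral_tsum_mul_tsum (hca : Continuous a) (ha : HasCompactSupport a)
    (hcb : Continuous b) (hb : HasCompactSupport b)
    (h : ∀ z : ℤ, z ≠ 0 → ∫ x, a x * b (x + z) = 0) :
    ∫ x, (∑' z : ℤ, a (x + z)) * (∑' z : ℤ, b (x + z)) ∂timeMeasure = ∫ x, a x * b x := by
  rw [← integral_mul_tsum hca ha hcb hb h]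
  exact integral_tsum_mul_of_periodic hca ha (continuous_tsum_comp_add_int hcb hb)
    (tsum_comp_add_int_add_int b)

end Periodization

section Periodized

variable {h : ℝ → ℝ}

theorem continuous_periodized (hc : Continuous h) (hs : HasCompactSupport h) (j : ℕ) (k : ℤ) :
    Continuous (periodized h j k) :=
  continuous_tsum_comp_add_int (continuous_dilate hc j k) (hasCompactSupport_dilate hs j k)

instance : IsProbabilityMeasure timeMeasure := ⟨by simp [timeMeasure]⟩

theorem memLp_timeMeasure_of_continuous (hc : Continuous h) : MemLp h 2 timeMeasure := by
  rw [memLp_two_iff_integrable_sq hc.aestronglyMeasurable]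
  exact (hc.pow 2).continuousOn.integrableOn_compact isCompact_Icc

theorem memLp_periodized (hc : Continuous h) (hs : HasCompactSupport h) (j : ℕ) (k : ℤ) :
    MemLp (periodized h j k) 2 timeMeasure :=
  memLp_timeMeasure_of_continuous (continuous_periodized hc hs j k)

theorem periodized_sub_two_pow_mul (h : ℝ → ℝ) (j : ℕ) (k n : ℤ) :
    periodized h j (k - 2 ^ j * n) = periodized h j k := by
  ext x
  simp only [periodized, ← dilate_add_int]
  rw [← (Equiv.addLeft n).tsum_eq fun z : ℤ => dilate h j k (x + z)]
  refine tsum_congr fun z => ?_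
  simp only [Equiv.coe_addLeft, Int.cast_add]
  congr 1
  ring

/-- A unit translation shifts the position by `2 ^ j`, so periodization only sees `k` modulo `2 ^
j`. -/
theorem exists_fin_periodized_eq (h : ℝ → ℝ) (j : ℕ) (k : ℤ) :
    ∃ l : Fin (2 ^ j), periodized h j k = periodized h j ((l : ℕ) : ℤ) := by
  have h2 : (0 : ℤ) < 2 ^ j := by positivity
  have h0 := Int.emod_nonneg k h2.ne'
  have h1 := Int.emod_lt_of_pos k h2
  refine ⟨⟨(k % 2 ^ j).toNat, ?_⟩, ?_⟩
  · zify
    rwa [Int.toNat_of_nonneg h0]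
  · rw [Int.toNat_of_nonneg h0, Int.emod_def, periodized_sub_two_pow_mul]

theorem periodized_eq_sum_of_dilate_eq_sum {ι : Type*} {s : Finset ι} {c : ι → ℝ}
    {g : ι → ℝ → ℝ} {js : ι → ℕ} {ks : ι → ℤ} (hg : ∀ i, HasCompactSupport (g i)) {j : ℕ} {k : ℤ}
    (heq : ∀ x, dilate h j k x = ∑ i ∈ s, c i * dilate (g i) (js i) (ks i) x) :
    periodized h j k = ∑ i ∈ s, c i • periodized (g i) (js i) (ks i) := by
  ext x
  simp only [periodized, heq, Finset.sum_apply, Pi.smul_apply, smul_eq_mul, ← tsum_mul_left]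
  refine Summable.tsum_finsetSum fun i _ => ?_
  exact (summable_comp_add_int (hasCompactSupport_dilate (hg i) _ _) x).mul_left _

theorem periodized_eq_dilate {j : ℕ} {k : ℤ} (h0 : ∀ x, x ∉ Set.Ioo (0 : ℝ) 1 → dilate h j k x = 0)
    {x : ℝ} (hx : x ∈ Set.Icc (0 : ℝ) 1) : periodized h j k x = dilate h j k x := by
  rw [periodized, tsum_eq_single (0 : ℤ)]
  · simp
  · intro z hz
    refine h0 _ fun hxz => hz ?_
    have h1 : (-1 : ℝ) < z := by linarith [hx.2, hxz.1]
    have h2 : (z : ℝ) < 1 := by linarith [hx.1, hxz.2]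
    have h3 : (-1 : ℤ) < z := by exact_mod_cast h1
    have h4 : z < 1 := by exact_mod_cast h2
    omega

theorem exists_finset_integral_dilate_mul_eq_zero (hs : HasCompactSupport h) (j : ℕ) {b : ℝ → ℝ}
    {R : ℝ} (hb : ∀ x, R < |x| → b x = 0) :
    ∃ s : Finset ℤ, ∀ k : ℤ, k ∉ s → ∫ x, dilate h j k x * b x = 0 := by
  obtain ⟨s, hs⟩ := exists_finset_int_of_bounded hs (2 ^ j * R)
  refine ⟨s.map (Equiv.neg ℤ).toEmbedding, fun k hk => ?_⟩
  have hk' : -k ∉ s := fun h1 => hk (Finset.mem_map.2 ⟨-k, h1, by simp⟩)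
  have h0 : ∀ x, dilate h j k x * b x = 0 := by
    intro x
    rcases lt_or_ge R |x| with hx | hx
    · rw [hb x hx, mul_zero]
    · have h1 := hs (2 ^ j * x) (by rw [abs_mul, abs_of_pos (by positivity)]; gcongr) (-k) hk'
      rw [Int.cast_neg, ← sub_eq_add_neg] at h1
      rw [dilate, h1, mul_zero, zero_mul]
  simp [h0]

end Periodized

/-! ### Finite expansions in closed spans of orthonormal families -/

/-- The difference of the two sides lies in the closed span and is orthogonal to it. This makes
two-scale relations of compactly supported wavelets finite sums. -/
theorem Orthonormal.eq_sum_of_mem_closure {E ι : Type*} [NormedAddCommGroup E]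
    [InnerProductSpace ℝ E] {v : ι → E} (hv : Orthonormal ℝ v) {y : E}
    (hy : y ∈ (Submodule.span ℝ (Set.range v)).topologicalClosure) {s : Finset ι}
    (hs : ∀ i, i ∉ s → inner ℝ (v i) y = 0) : y = ∑ i ∈ s, inner ℝ (v i) y • v i := by
  classical
  set w := ∑ i ∈ s, inner ℝ (v i) y • v i with hw
  have h1 : y - w ∈ (Submodule.span ℝ (Set.range v)).topologicalClosure := by
    refine sub_mem hy (Submodule.le_topologicalClosure _ ?_)
    exact Submodule.sum_mem _ fun i _ =>
      Submodule.smul_mem _ _ (Submodule.subset_span ⟨i, rfl⟩)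
  have h2 : y - w ∈ (Submodule.span ℝ (Set.range v))ᗮ := by
    rw [Submodule.mem_orthogonal]
    intro u hu
    induction hu using Submodule.span_induction with
    | mem u hu =>
      obtain ⟨i, rfl⟩ := hu
      rw [inner_sub_right, hw]
      by_cases hi : i ∈ s
      · rw [hv.inner_right_sum _ hi, sub_self]
      · rw [hs i hi, inner_sum, zero_sub, neg_eq_zero]
        refine Finset.sum_eq_zero fun l hl => ?_
        rw [inner_smul_right, hv.2 (by rintro rfl; exact hi hl), mul_zero]
    | zero => simp
    | add u u' _ _ h h' => rw [inner_add_left, h, h', add_zero]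
    | smul c u _ h => rw [inner_smul_left, h, mul_zero]
  rw [← Submodule.orthogonal_closure] at h2
  exact sub_eq_zero.1 ((Submodule.inf_orthogonal_eq_bot _).le ⟨h1, h2⟩)

/-! ### Multiresolution analysis on the line and its finite two-scale relations. -/

namespace WaveletSystem

variable {τ : ℕ} (S : WaveletSystem τ)

/-- The element of `L²(ℝ)` given by `φ_{j,k}`. -/
noncomputable abbrev φL2 (j : ℕ) (k : ℤ) : Lp ℝ 2 (volume : Measure ℝ) :=
  dilateL2 S.φ S.contDiff_φ.continuous S.compact_φ j k

/-- The element of `L²(ℝ)` given by `ψ_{j,k}`. -/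
noncomputable abbrev ψL2 (j : ℕ) (k : ℤ) : Lp ℝ 2 (volume : Measure ℝ) :=
  dilateL2 S.ψ S.contDiff_ψ.continuous S.compact_ψ j k

/-- The approximation space `V_j`. -/
noncomputable abbrev V (j : ℕ) : Submodule ℝ (Lp ℝ 2 (volume : Measure ℝ)) :=
  levelSpace S.φ S.contDiff_φ.continuous S.compact_φ j

/-- The detail space `W_j`. -/
noncomputable abbrev W (j : ℕ) : Submodule ℝ (Lp ℝ 2 (volume : Measure ℝ)) :=
  levelSpace S.ψ S.contDiff_ψ.continuous S.compact_ψ j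

theorem φL2_mem (j : ℕ) (k : ℤ) : S.φL2 j k ∈ S.V j :=
  Submodule.le_topologicalClosure _ (Submodule.subset_span ⟨k, rfl⟩)

theorem ψL2_mem (j : ℕ) (k : ℤ) : S.ψL2 j k ∈ S.W j :=
  Submodule.le_topologicalClosure _ (Submodule.subset_span ⟨k, rfl⟩)

theorem monotone_V : Monotone S.V := monotone_nat_of_le_succ S.nested

theorem W_le_V_succ (j : ℕ) : S.W j ≤ S.V (j + 1) := by
  rw [V, W, S.complement j]
  exact inf_le_right

theorem W_le_orthogonal (j : ℕ) : S.W j ≤ (S.V j)ᗮ := by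
  rw [V, W, S.complement j]
  exact inf_le_left

theorem inner_φL2_ψL2 {j j' : ℕ} (hj : j ≤ j') (k k' : ℤ) :
    inner ℝ (S.φL2 j k) (S.ψL2 j' k') = 0 :=
  (Submodule.mem_orthogonal _ _).1 (S.W_le_orthogonal j' (S.ψL2_mem j' k')) _
    (S.monotone_V hj (S.φL2_mem j k))

theorem inner_ψL2_ψL2 {j j' : ℕ} (hj : j < j') (k k' : ℤ) :
    inner ℝ (S.ψL2 j k) (S.ψL2 j' k') = 0 :=
  (Submodule.mem_orthogonal _ _).1 (S.W_le_orthogonal j' (S.ψL2_mem j' k')) _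
    (S.monotone_V hj (S.W_le_V_succ j (S.ψL2_mem j k)))

theorem inner_dilateL2 {h h' : ℝ → ℝ} (hc : Continuous h) (hs : HasCompactSupport h)
    (hc' : Continuous h') (hs' : HasCompactSupport h') (j j' : ℕ) (k k' : ℤ) :
    inner ℝ (dilateL2 h hc hs j k) (dilateL2 h' hc' hs' j' k') =
      ∫ x, dilate h j k x * dilate h' j' k' x :=
  inner_toLp _ _

/-- Continuous functions that agree almost everywhere agree everywhere. Periodization evaluates at
points, so the `L²` identity alone would not do. -/
theorem dilate_eq_sum_of_L2_eq_sum {ι : Type*} {s : Finset ι} {c : ι → ℝ} {g : ι → ℝ → ℝ}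
    {js : ι → ℕ} {ks : ι → ℤ} (hgc : ∀ i, Continuous (g i)) (hg : ∀ i, HasCompactSupport (g i))
    {h : ℝ → ℝ} {hc : Continuous h} {hs : HasCompactSupport h} {j : ℕ} {k : ℤ}
    (heq : dilateL2 h hc hs j k =
      ∑ i ∈ s, c i • dilateL2 (g i) (hgc i) (hg i) (js i) (ks i)) (x : ℝ) :
    dilate h j k x = ∑ i ∈ s, c i * dilate (g i) (js i) (ks i) x := by
  have h1 : dilate h j k =ᵐ[volume] fun x => ∑ i ∈ s, c i * dilate (g i) (js i) (ks i) x := by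
    have h2 : MemLp (fun x => ∑ i ∈ s, c i * dilate (g i) (js i) (ks i) x) 2
        (volume : Measure ℝ) :=
      memLp_finsetSum _ fun i _ => (memLp_dilate (hgc i) (hg i) (js i) (ks i)).const_mul (c i)
    have h3 : h2.toLp _ = ∑ i ∈ s, c i • dilateL2 (g i) (hgc i) (hg i) (js i) (ks i) := by
      refine Lp.ext ?_
      refine h2.coeFn_toLp.trans ?_
      refine Filter.EventuallyEq.trans ?_ (Lp.coeFn_finsetSum _ _).symm
      have h4 : ∀ᵐ x : ℝ, ∀ i ∈ s,
          (c i • dilateL2 (g i) (hgc i) (hg i) (js i) (ks i) : Lp ℝ 2 (volume : Measure ℝ)) x =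
            c i * dilate (g i) (js i) (ks i) x := by
        rw [Filter.eventually_all_finset]
        intro i _
        filter_upwards [Lp.coeFn_smul (c i) (dilateL2 (g i) (hgc i) (hg i) (js i) (ks i)),
          (memLp_dilate (hgc i) (hg i) (js i) (ks i)).coeFn_toLp] with x h5 h6
        rw [h5, Pi.smul_apply, smul_eq_mul, dilateL2, h6]
      filter_upwards [h4] with x hx
      rw [Finset.sum_apply]
      exact (Finset.sum_congr rfl hx).symm
    rw [← h3] at heq
    exact (MemLp.toLp_eq_toLp_iff _ h2).1 heq
  have h2 := (Continuous.ae_eq_iff_eq volume (continuous_dilate hc j k)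
    (continuous_finsetSum _ fun i _ =>
      continuous_const.mul (continuous_dilate (hgc i) _ _))).1 h1
  exact congrFun h2 x

theorem exists_finset_inner_dilateL2 {h h' : ℝ → ℝ} (hc : Continuous h) (hs : HasCompactSupport h)
    (hc' : Continuous h') (hs' : HasCompactSupport h') (j j' : ℕ) (k' : ℤ) :
    ∃ s : Finset ℤ, ∀ k : ℤ, k ∉ s →
      inner ℝ (dilateL2 h hc hs j k) (dilateL2 h' hc' hs' j' k') = 0 := by
  obtain ⟨R, -, hR⟩ := (hasCompactSupport_dilate hs' j' k').exists_pos_le_norm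
  obtain ⟨s, hs1⟩ := exists_finset_integral_dilate_mul_eq_zero hs j
    (b := dilate h' j' k') (R := R) fun x hx => hR x hx.le
  exact ⟨s, fun k hk => by rw [inner_dilateL2]; exact hs1 k hk⟩

theorem exists_φL2_eq_sum_succ (j : ℕ) (k : ℤ) :
    ∃ (s : Finset ℤ) (c : ℤ → ℝ), S.φL2 j k = ∑ l ∈ s, c l • S.φL2 (j + 1) l := by
  obtain ⟨s, hs⟩ := exists_finset_inner_dilateL2 S.contDiff_φ.continuous S.compact_φ
    S.contDiff_φ.continuous S.compact_φ (j + 1) j k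
  exact ⟨s, _, Orthonormal.eq_sum_of_mem_closure (S.orthonormal_φ (j + 1))
    (S.nested j (S.φL2_mem j k)) hs⟩

instance (j : ℕ) : (S.V j).HasOrthogonalProjection := by
  have : CompleteSpace (S.V j) :=
    (Submodule.isClosed_topologicalClosure _).completeSpace_coe
  infer_instance

/-- Split `φ_{j+1,k}` into its projection on `V_j` and a remainder, which lies in `W_j`. Each part
has the same coefficients in its own basis as the whole function, and these vanish for all but
finitely many positions. -/
theorem exists_φL2_succ_eq_sum_add_sum (j : ℕ) (k : ℤ) :
    ∃ (s t : Finset ℤ) (c c' : ℤ → ℝ),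
      S.φL2 (j + 1) k = ∑ l ∈ s, c l • S.φL2 j l + ∑ l ∈ t, c' l • S.ψL2 j l := by
  obtain ⟨s, hs⟩ := exists_finset_inner_dilateL2 S.contDiff_φ.continuous S.compact_φ
    S.contDiff_φ.continuous S.compact_φ j (j + 1) k
  obtain ⟨t, ht⟩ := exists_finset_inner_dilateL2 S.contDiff_ψ.continuous S.compact_ψ
    S.contDiff_φ.continuous S.compact_φ j (j + 1) k
  set x := S.φL2 (j + 1) k with hx
  set y := (S.V j).starProjection x with hy
  have hyV : y ∈ S.V j := Submodule.starProjection_apply_mem _ _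
  have hxy : x - y ∈ (S.V j)ᗮ := Submodule.sub_starProjection_mem_orthogonal _
  have hxyW : x - y ∈ S.W j := by
    rw [W, S.complement j]
    exact ⟨hxy, sub_mem (S.φL2_mem (j + 1) k) (S.nested j hyV)⟩
  have h1 := Orthonormal.eq_sum_of_mem_closure (S.orthonormal_φ j) hyV (s := s) fun l hl => by
    have h2 := (Submodule.mem_orthogonal _ _).1 hxy _ (S.φL2_mem j l)
    rw [inner_sub_right, sub_eq_zero] at h2
    rw [← h2]
    exact hs l hl
  have h2 := Orthonormal.eq_sum_of_mem_closure (S.orthonormal_ψ j) hxyW (s := t) fun l hl => by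
    rw [inner_sub_right]
    have h3 : inner ℝ (S.ψL2 j l) y = 0 :=
      (Submodule.mem_orthogonal' _ _).1 (S.W_le_orthogonal j (S.ψL2_mem j l)) _ hyV
    rw [h3, sub_zero]
    exact ht l hl
  refine ⟨s, t, fun l => inner ℝ (S.φL2 j l) y, fun l => inner ℝ (S.ψL2 j l) (x - y), ?_⟩
  calc x = y + (x - y) := by abel
    _ = _ := congrArg₂ (· + ·) h1 h2

/-! ### Periodized wavelets on the unit interval -/

/-- The father wavelet for `false` and the mother wavelet for `true`. -/
noncomputable abbrev generator (b : Bool) : ℝ → ℝ := if b = true then S.ψ else S.φ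

theorem continuous_generator (b : Bool) : Continuous (S.generator b) := by
  cases b
  · exact S.contDiff_φ.continuous
  · exact S.contDiff_ψ.continuous

theorem hasCompactSupport_generator (b : Bool) : HasCompactSupport (S.generator b) := by
  cases b
  · exact S.compact_φ
  · exact S.compact_ψ

theorem orthonormal_generator (b : Bool) (j : ℕ) :
    Orthonormal ℝ (dilateL2 (S.generator b) (S.continuous_generator b)
      (S.hasCompactSupport_generator b) j) := by
  cases b
  · exact S.orthonormal_φ j
  · exact S.orthonormal_ψ j

theorem periodized_φ_mem_span_succ (j : ℕ) (k : ℤ) :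
    periodized S.φ j k ∈ Submodule.span ℝ (Set.range (periodized S.φ (j + 1))) := by
  obtain ⟨s, c, h⟩ := S.exists_φL2_eq_sum_succ j k
  rw [periodized_eq_sum_of_dilate_eq_sum (fun _ => S.compact_φ)
    (dilate_eq_sum_of_L2_eq_sum (fun _ => S.contDiff_φ.continuous) (fun _ => S.compact_φ) h)]
  exact Submodule.sum_mem _ fun l _ => Submodule.smul_mem _ _ (Submodule.subset_span ⟨l, rfl⟩)

theorem periodized_φ_mem_span_of_le {j j' : ℕ} (hj : j ≤ j') (k : ℤ) :
    periodized S.φ j k ∈ Submodule.span ℝ (Set.range (periodized S.φ j')) := by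
  have hmono : Monotone fun j => Submodule.span ℝ (Set.range (periodized S.φ j)) := by
    refine monotone_nat_of_le_succ fun j => Submodule.span_le.2 ?_
    rintro _ ⟨k, rfl⟩
    exact S.periodized_φ_mem_span_succ j k
  exact hmono hj (Submodule.subset_span ⟨k, rfl⟩)

theorem periodized_φ_succ_mem_span (j : ℕ) (k : ℤ) :
    periodized S.φ (j + 1) k ∈ Submodule.span ℝ
      (Set.range fun p : Bool × ℤ => periodized (S.generator p.1) j p.2) := by
  obtain ⟨s, t, c, c', h⟩ := S.exists_φL2_succ_eq_sum_add_sum j k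
  let p : ℤ ⊕ ℤ → Bool × ℤ := Sum.elim (fun l => (false, l)) (fun l => (true, l))
  have h1 : S.φL2 (j + 1) k = ∑ i ∈ s.disjSum t, Sum.elim c c' i •
      dilateL2 (S.generator (p i).1) (S.continuous_generator _)
        (S.hasCompactSupport_generator _) j (p i).2 := by
    rw [Finset.sum_disjSum]
    exact h
  rw [periodized_eq_sum_of_dilate_eq_sum (fun i => S.hasCompactSupport_generator (p i).1)
    (dilate_eq_sum_of_L2_eq_sum (fun i => S.continuous_generator (p i).1)
      (fun i => S.hasCompactSupport_generator (p i).1) h1)]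
  exact Submodule.sum_mem _ fun l _ => Submodule.smul_mem _ _ (Submodule.subset_span ⟨p l, rfl⟩)

theorem integral_periodized_mul_self (b : Bool) (j : ℕ) (l l' : Fin (2 ^ j)) :
    ∫ x, periodized (S.generator b) j ((l : ℕ) : ℤ) x *
      periodized (S.generator b) j ((l' : ℕ) : ℤ) x ∂timeMeasure = if l = l' then 1 else 0 := by
  have hc := S.continuous_generator b
  have hs := S.hasCompactSupport_generator b
  have ho := orthonormal_iff_ite.1 (S.orthonormal_generator b j)
  simp only [inner_dilateL2] at ho
  refine (integral_tsum_mul_tsum (continuous_dilate hc _ _) (hasCompactSupport_dilate hs _ _)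
    (continuous_dilate hc _ _) (hasCompactSupport_dilate hs _ _) fun z hz => ?_).trans ?_
  · simp only [dilate_add_int, ho]
    rw [if_neg]
    -- Two positions in `[0, 2 ^ j)` differ by less than `2 ^ j`, hence not by a nonzero multiple of
    -- it.
    intro heq
    have h1 : (l : ℤ) < 2 ^ j := by exact_mod_cast l.2
    have h2 : (l' : ℤ) < 2 ^ j := by exact_mod_cast l'.2
    have h3 : |(2 : ℤ) ^ j * z| < 2 ^ j := by
      rw [abs_lt]
      constructor <;> omega
    rw [abs_mul, abs_of_pos (by positivity)] at h3
    have h4 := Int.one_le_abs hz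
    nlinarith [pow_pos (two_pos : (0 : ℤ) < 2) j]
  · rw [ho]
    simp [Fin.ext_iff]

theorem integral_periodized_φ_mul_ψ {j j' : ℕ} (hj : j ≤ j') (k k' : ℤ) :
    ∫ x, periodized S.φ j k x * periodized S.ψ j' k' x ∂timeMeasure = 0 := by
  have h : ∀ k k', ∫ x, dilate S.φ j k x * dilate S.ψ j' k' x = 0 := fun k k' => by
    rw [← inner_dilateL2 S.contDiff_φ.continuous S.compact_φ S.contDiff_ψ.continuous S.compact_ψ]
    exact S.inner_φL2_ψL2 hj k k'
  refine (integral_tsum_mul_tsum (continuous_dilate S.contDiff_φ.continuous _ _)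
    (hasCompactSupport_dilate S.compact_φ _ _) (continuous_dilate S.contDiff_ψ.continuous _ _)
    (hasCompactSupport_dilate S.compact_ψ _ _) fun z _ => ?_).trans (h k k')
  simp only [dilate_add_int, h]

theorem integral_periodized_ψ_mul_ψ {j j' : ℕ} (hj : j < j') (k k' : ℤ) :
    ∫ x, periodized S.ψ j k x * periodized S.ψ j' k' x ∂timeMeasure = 0 := by
  have h : ∀ k k', ∫ x, dilate S.ψ j k x * dilate S.ψ j' k' x = 0 := fun k k' => by
    rw [← inner_dilateL2 S.contDiff_ψ.continuous S.compact_ψ S.contDiff_ψ.continuous S.compact_ψ]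
    exact S.inner_ψL2_ψL2 hj k k'
  refine (integral_tsum_mul_tsum (continuous_dilate S.contDiff_ψ.continuous _ _)
    (hasCompactSupport_dilate S.compact_ψ _ _) (continuous_dilate S.contDiff_ψ.continuous _ _)
    (hasCompactSupport_dilate S.compact_ψ _ _) fun z _ => ?_).trans (h k k')
  simp only [dilate_add_int, h]

theorem integral_periodized_generator_mul_ψ (b : Bool) {j j' : ℕ} (hj : j < j') (k k' : ℤ) :
    ∫ x, periodized (S.generator b) j k x * periodized S.ψ j' k' x ∂timeMeasure = 0 := by
  cases b
  · exact S.integral_periodized_φ_mul_ψ hj.le k k'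
  · exact S.integral_periodized_ψ_mul_ψ hj k k'

theorem integral_periodized_generator_mul_ne {b b' : Bool} (hb : b ≠ b') (j : ℕ) (k k' : ℤ) :
    ∫ x, periodized (S.generator b) j k x * periodized (S.generator b') j k' x ∂timeMeasure = 0 := by
  cases b <;> cases b'
  · exact absurd rfl hb
  · exact S.integral_periodized_φ_mul_ψ le_rfl k k'
  · simp only [mul_comm (periodized (S.generator true) _ _ _)]
    exact S.integral_periodized_φ_mul_ψ le_rfl k' k
  · exact absurd rfl hb

/-! ### Totality of the periodized scaling functions -/

/-- Two points where the dilate is nonzero are less than `2R / 2 ^ j` apart. -/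
theorem dilate_eq_zero_of_far {h : ℝ → ℝ} {R δ : ℝ} (hR : ∀ x, R ≤ ‖x‖ → h x = 0) {j : ℕ}
    (hj : 2 * R ≤ 2 ^ j * δ) {k : ℤ} {x₀ x : ℝ} (hx₀ : dilate h j k x₀ ≠ 0) (hx : δ ≤ |x - x₀|) :
    dilate h j k x = 0 := by
  have h1 : |2 ^ j * x₀ - k| < R := by
    by_contra! hle
    exact hx₀ (by rw [dilate, hR _ hle, mul_zero])
  rw [dilate, hR, mul_zero]
  have h2 : (2 : ℝ) ^ j * δ ≤ |2 ^ j * (x - x₀)| := by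
    rw [abs_mul, abs_of_pos (by positivity : (0 : ℝ) < 2 ^ j)]
    gcongr
  have h3 : (2 : ℝ) ^ j * (x - x₀) = (2 ^ j * x - k) - (2 ^ j * x₀ - k) := by ring
  rw [h3] at h2
  have h4 := abs_sub (2 ^ j * x - (k : ℝ)) (2 ^ j * x₀ - k)
  rw [Real.norm_eq_abs]
  linarith

/-- The integral equals `⟨H, G⟩`, with `G` the extension of `f` by zero and `H` its restriction to
`[δ, 1 - δ]`. It is the limit of `⟨P_j H, G⟩`, with `P_j` the projection on `V_j`, and these numbers
vanish for large `j`: in the expansion of `P_j H`, each term has either a zero coefficient or a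
scaling function orthogonal to `G`. -/
theorem setIntegral_sq_eq_zero {f : ℝ → ℝ} (hf : MemLp f 2 timeMeasure)
    (hz : ∀ (j : ℕ) (k : ℤ), ∫ x, f x * periodized S.φ j k x ∂timeMeasure = 0) {δ : ℝ}
    (hδ : 0 < δ) : ∫ x in Set.Icc δ (1 - δ), f x ^ 2 = 0 := by
  set G : ℝ → ℝ := Set.indicator (Set.Icc 0 1) f with hG
  set H : ℝ → ℝ := Set.indicator (Set.Icc δ (1 - δ)) f with hH
  have hsub : Set.Icc δ (1 - δ) ⊆ Set.Icc 0 1 := Set.Icc_subset_Icc hδ.le (by linarith)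
  have hGm : MemLp G 2 volume := (memLp_indicator_iff_restrict measurableSet_Icc).2 hf
  have hHm : MemLp H 2 volume := (memLp_indicator_iff_restrict measurableSet_Icc).2
    (hf.mono_measure (Measure.restrict_mono hsub le_rfl))
  have hφc := S.contDiff_φ.continuous
  have hlim := Submodule.starProjection_tendsto_self S.V S.monotone_V (hHm.toLp H) S.dense.ge
  have hlim' := hlim.inner (𝕜 := ℝ) (tendsto_const_nhds (x := hGm.toLp G))
  obtain ⟨R, hR0, hR⟩ := S.compact_φ.exists_pos_le_norm
  have hzero : ∀ᶠ j : ℕ in Filter.atTop,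
      inner ℝ ((S.V j).starProjection (hHm.toLp H)) (hGm.toLp G) = 0 := by
    have h2 : ∀ᶠ j : ℕ in Filter.atTop, 2 * R / δ ≤ (2 : ℝ) ^ j :=
      (tendsto_pow_atTop_atTop_of_one_lt one_lt_two).eventually_ge_atTop _
    filter_upwards [h2] with j hj
    rw [div_le_iff₀ hδ] at hj
    obtain ⟨s, hs⟩ := exists_finset_integral_dilate_mul_eq_zero S.compact_φ j (b := H) (R := 1)
      fun x hx => Set.indicator_of_notMem (fun hx' => by
        have := hsub hx'
        rw [abs_of_nonneg this.1] at hx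
        exact absurd this.2 hx.not_ge) _
    have hPH : ∀ k, inner ℝ (S.φL2 j k) ((S.V j).starProjection (hHm.toLp H)) =
        ∫ x, dilate S.φ j k x * H x := fun k => by
      have h3 := (Submodule.mem_orthogonal _ _).1
        (Submodule.sub_starProjection_mem_orthogonal (K := S.V j) (hHm.toLp H)) _ (S.φL2_mem j k)
      rw [inner_sub_right, sub_eq_zero] at h3
      rw [← h3]
      exact inner_toLp _ _
    rw [Orthonormal.eq_sum_of_mem_closure (S.orthonormal_φ j)
      (Submodule.starProjection_apply_mem (S.V j) (hHm.toLp H)) (s := s)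
      fun k hk => by rw [hPH]; exact hs k hk, sum_inner]
    refine Finset.sum_eq_zero fun k _ => ?_
    rw [real_inner_smul_left, hPH]
    -- If `φ_{j,k}` vanishes off `(0,1)`, it equals its periodization on `[0,1]`, and the hypothesis
    -- on `f` applies.
    by_cases hk : ∀ x, x ∉ Set.Ioo (0 : ℝ) 1 → dilate S.φ j k x = 0
    · have h3 : inner ℝ (S.φL2 j k) (hGm.toLp G) = ∫ x, dilate S.φ j k x * G x := inner_toLp _ _
      rw [h3, ← hz j k]
      have h4 : ∀ x, dilate S.φ j k x * G x =
          Set.indicator (Set.Icc 0 1) (fun x => f x * periodized S.φ j k x) x := fun x => by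
        by_cases hx : x ∈ Set.Icc (0 : ℝ) 1
        · rw [hG, Set.indicator_of_mem hx, Set.indicator_of_mem hx, periodized_eq_dilate hk hx,
            mul_comm]
        · rw [hG, Set.indicator_of_notMem hx, Set.indicator_of_notMem hx, mul_zero]
      simp only [h4]
      rw [integral_indicator measurableSet_Icc, timeMeasure]
      have h5 := hz j k
      rw [timeMeasure] at h5
      rw [h5, mul_zero]
    -- Otherwise `φ_{j,k}` is nonzero at a point outside `(0,1)`, at distance at least `δ` from `[δ,
    -- 1 - δ]`. At this scale it vanishes on that interval, so its product with `H` is zero.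
    · push Not at hk
      obtain ⟨x₀, hx₀, hne⟩ := hk
      have h3 : ∀ x, dilate S.φ j k x * H x = 0 := fun x => by
        by_cases hx : x ∈ Set.Icc δ (1 - δ)
        · rw [dilate_eq_zero_of_far hR hj hne, zero_mul]
          by_contra! hlt
          rw [abs_lt] at hlt
          exact hx₀ ⟨by linarith [hx.1], by linarith [hx.2]⟩
        · rw [hH, Set.indicator_of_notMem hx, mul_zero]
      simp [h3]
  have h1 : inner ℝ (hHm.toLp H) (hGm.toLp G) = 0 :=
    tendsto_nhds_unique hlim' (tendsto_const_nhds.congr' (hzero.mono fun _ h => h.symm))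
  rw [inner_toLp] at h1
  rw [← h1, ← integral_indicator measurableSet_Icc]
  congr 1
  ext x
  by_cases hx : x ∈ Set.Icc δ (1 - δ)
  · rw [hH, hG, Set.indicator_of_mem hx, Set.indicator_of_mem hx, Set.indicator_of_mem (hsub hx),
      sq]
  · rw [hH, Set.indicator_of_notMem hx, Set.indicator_of_notMem hx, zero_mul]

/-- The intervals `[δ, 1 - δ]` with `δ = 1/(n+1)` exhaust `(0,1)`, and the endpoints are null. -/
theorem isTotal_periodized_φ :
    IsTotal timeMeasure fun p : ℕ × ℤ => periodized S.φ p.1 p.2 := by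
  intro f hf hz
  have h1 : ∀ n : ℕ, ∀ᵐ x : ℝ, x ∈ Set.Icc (1 / ((n : ℝ) + 1)) (1 - 1 / ((n : ℝ) + 1)) →
      f x = 0 := fun n => by
    have hδ : (0 : ℝ) < 1 / ((n : ℝ) + 1) := Nat.one_div_pos_of_nat
    have h2 := S.setIntegral_sq_eq_zero hf (fun j k => hz (j, k)) hδ
    rw [integral_eq_zero_iff_of_nonneg (fun x => sq_nonneg _)] at h2
    · rw [← ae_restrict_iff' measurableSet_Icc]
      filter_upwards [h2] with x hx
      exact pow_eq_zero_iff two_ne_zero |>.1 hx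
    · exact (hf.mono_measure (Measure.restrict_mono
        (Set.Icc_subset_Icc hδ.le (by linarith)) le_rfl)).integrable_sq
  have h2 : ∀ᵐ x ∂(volume.restrict (Set.Ioo (0 : ℝ) 1)), f x = 0 := by
    rw [ae_restrict_iff' measurableSet_Ioo]
    filter_upwards [ae_all_iff.2 h1] with x hx hx01
    obtain ⟨n, hn⟩ := exists_nat_one_div_lt (lt_min hx01.1 (sub_pos.2 hx01.2))
    rw [lt_min_iff] at hn
    exact hx n ⟨hn.1.le, by linarith [hn.2]⟩
  rw [timeMeasure, ← restrict_Ioo_eq_restrict_Icc]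
  exact h2

end WaveletSystem

/-! ### Spans: transfer of totality, and products of functions. -/

section Span

variable {α ι κ : Type*} [MeasurableSpace α] {μ : Measure α}

theorem memLp_and_integral_mul_eq_zero_of_mem_span {e : ι → α → ℝ} (hm : ∀ i, MemLp (e i) 2 μ)
    {f : α → ℝ} (hf : MemLp f 2 μ) (hz : ∀ i, ∫ x, f x * e i x ∂μ = 0) {g : α → ℝ}
    (hg : g ∈ Submodule.span ℝ (Set.range e)) : MemLp g 2 μ ∧ ∫ x, f x * g x ∂μ = 0 := by
  induction hg using Submodule.span_induction with
  | mem g hg =>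
    obtain ⟨i, rfl⟩ := hg
    exact ⟨hm i, hz i⟩
  | zero => simp
  | add g g' _ _ h h' =>
    refine ⟨h.1.add h'.1, ?_⟩
    simp only [Pi.add_apply, mul_add]
    rw [integral_add (integrable_mul_of_memLp hf h.1) (integrable_mul_of_memLp hf h'.1), h.2, h'.2,
      add_zero]
  | smul c g _ h =>
    refine ⟨h.1.const_smul c, ?_⟩
    simp only [Pi.smul_apply, smul_eq_mul, mul_left_comm _ c]
    rw [integral_const_mul, h.2, mul_zero]

theorem IsTotal.of_mem_span {e : ι → α → ℝ} {e' : κ → α → ℝ} (h : IsTotal μ e')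
    (hm : ∀ i, MemLp (e i) 2 μ) (hs : ∀ i, e' i ∈ Submodule.span ℝ (Set.range e)) :
    IsTotal μ e := fun _ hf hz =>
  h _ hf fun i => (memLp_and_integral_mul_eq_zero_of_mem_span hm hf hz (hs i)).2

end Span

/-- The product is linear in each factor, so factors in `G` can be replaced by factors in its span
one coordinate at a time. -/
theorem prod_mem_of_forall_mem_span {α : Type*} {d : ℕ} {G : Set (α → ℝ)}
    {M : Submodule ℝ ((Fin d → α) → ℝ)}
    (hM : ∀ g : Fin d → α → ℝ, (∀ i, g i ∈ G) → (fun x => ∏ i, g i (x i)) ∈ M)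
    (g : Fin d → α → ℝ) (hg : ∀ i, g i ∈ Submodule.span ℝ G) :
    (fun x : Fin d → α => ∏ i, g i (x i)) ∈ M := by
  classical
  -- Here `s` is the set of coordinates already relaxed from `G` to its span.
  have key : ∀ s : Finset (Fin d), ∀ g : Fin d → α → ℝ, (∀ i ∈ s, g i ∈ Submodule.span ℝ G) →
      (∀ i, i ∉ s → g i ∈ G) → (fun x : Fin d → α => ∏ i, g i (x i)) ∈ M := by
    intro s
    induction s using Finset.induction_on with
    | empty => exact fun g _ h => hM g fun i => h i (Finset.notMem_empty i)
    | insert a s ha ih =>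
      intro g hg hg'
      have hsplit : ∀ (u : α → ℝ) (x : Fin d → α),
          ∏ i, Function.update g a u i (x i) = u (x a) * ∏ i ∈ Finset.univ.erase a, g i (x i) := by
        intro u x
        rw [← Finset.mul_prod_erase _ _ (Finset.mem_univ a), Function.update_self]
        congr 1
        refine Finset.prod_congr rfl fun i hi => ?_
        rw [Function.update_of_ne (Finset.ne_of_mem_erase hi)]
      have h1 : ∀ u ∈ Submodule.span ℝ G,
          (fun x : Fin d → α => ∏ i, Function.update g a u i (x i)) ∈ M := by
        intro u hu
        induction hu using Submodule.span_induction with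
        | mem u hu =>
          refine ih _ (fun i hi => ?_) fun i hi => ?_
          · rw [Function.update_of_ne (by rintro rfl; exact ha hi)]
            exact hg i (Finset.mem_insert_of_mem hi)
          · by_cases hia : i = a
            · subst hia
              rwa [Function.update_self]
            · rw [Function.update_of_ne hia]
              exact hg' i fun h => (Finset.mem_insert.1 h).elim hia hi
        | zero =>
          simp only [hsplit, Pi.zero_apply, zero_mul]
          exact M.zero_mem
        | add u v _ _ hu hv =>
          simp only [hsplit, Pi.add_apply, add_mul] at hu hv ⊢
          exact M.add_mem hu hv
        | smul c u _ hu =>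
          simp only [hsplit, Pi.smul_apply, smul_eq_mul, mul_assoc] at hu ⊢
          exact M.smul_mem c hu
      have h2 := h1 (g a) (hg a (Finset.mem_insert_self _ _))
      rwa [Function.update_eq_self] at h2
  exact key Finset.univ g (fun i _ => hg i) fun i hi => absurd (Finset.mem_univ i) hi

/-! ### The wavelet bases of `L²(T)`, `L²(X)` and `L²(T × X)` -/

section Bases

variable {τ : ℕ} (S : WaveletSystem τ)

theorem memLp_timeWavelet (n : ℕ) (l : TimeIdx n) : MemLp (timeWavelet S n l) 2 timeMeasure := by
  refine memLp_periodized ?_ ?_ _ _ <;> split_ifs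
  exacts [S.contDiff_φ.continuous, S.contDiff_ψ.continuous, S.compact_φ, S.compact_ψ]

theorem integral_timeWavelet_mul_of_lt {n m : ℕ} (h : n < m) (l : TimeIdx n) (l' : TimeIdx m) :
    ∫ t, timeWavelet S n l t * timeWavelet S m l' t ∂timeMeasure = 0 := by
  obtain ⟨m, rfl⟩ := Nat.exists_eq_succ_of_ne_zero (Nat.ne_of_gt (Nat.zero_lt_of_lt h))
  cases n with
  | zero => exact S.integral_periodized_φ_mul_ψ (Nat.zero_le m) _ _
  | succ n => exact S.integral_periodized_ψ_mul_ψ (Nat.lt_of_succ_lt_succ h) _ _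

theorem integral_timeWavelet_mul (n : ℕ) (l l' : TimeIdx n) :
    ∫ t, timeWavelet S n l t * timeWavelet S n l' t ∂timeMeasure = if l = l' then 1 else 0 := by
  cases n with
  | zero => exact S.integral_periodized_mul_self false _ l l'
  | succ n => exact S.integral_periodized_mul_self true n l l'

theorem periodized_φ_mem_span_timeWavelet (j : ℕ) (k : ℤ) :
    periodized S.φ j k ∈ Submodule.span ℝ
      (Set.range fun i : (n : ℕ) × TimeIdx n => timeWavelet S i.1 i.2) := by
  induction j generalizing k with
  | zero =>
    obtain ⟨l, hl⟩ := exists_fin_periodized_eq S.φ 0 k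
    exact Submodule.subset_span ⟨⟨0, l⟩, hl.symm⟩
  | succ j ih =>
    refine Submodule.span_le.2 ?_ (S.periodized_φ_succ_mem_span j k)
    rintro _ ⟨⟨b, k⟩, rfl⟩
    cases b with
    | false => exact ih k
    | true =>
      obtain ⟨l, hl⟩ := exists_fin_periodized_eq S.ψ j k
      exact Submodule.subset_span ⟨⟨j + 1, l⟩, hl.symm⟩

theorem isL2Basis_timeWavelet :
    IsL2Basis timeMeasure fun i : (n : ℕ) × TimeIdx n => timeWavelet S i.1 i.2 where
  memLp i := memLp_timeWavelet S i.1 i.2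
  integral_sq i := by rw [integral_timeWavelet_mul, if_pos rfl]
  integral_mul := by
    rintro ⟨n, l⟩ ⟨m, l'⟩ hne
    rcases lt_trichotomy n m with h | rfl | h
    · exact integral_timeWavelet_mul_of_lt S h l l'
    · rw [integral_timeWavelet_mul, if_neg]
      rintro rfl
      exact hne rfl
    · simp only [mul_comm (timeWavelet S n l _)]
      exact integral_timeWavelet_mul_of_lt S h l' l
  total := S.isTotal_periodized_φ.of_mem_span (fun i => memLp_timeWavelet S i.1 i.2)
    fun p => periodized_φ_mem_span_timeWavelet S p.1 p.2

theorem spaceMeasure_eq_pi (d : ℕ) : spaceMeasure d = Measure.pi fun _ : Fin d => timeMeasure := by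
  unfold spaceMeasure timeMeasure
  rw [← Measure.restrict_pi_pi, ← volume_pi, Set.pi_univ_Icc]
  rfl

instance (d : ℕ) : IsProbabilityMeasure (spaceMeasure d) := by
  rw [spaceMeasure_eq_pi]
  infer_instance

instance (d : ℕ) : IsProbabilityMeasure (stMeasure d) := by
  unfold stMeasure
  infer_instance

variable {d : ℕ}

theorem memLp_spaceWavelet (n : ℕ) (idx : SpaceIdx d n) :
    MemLp (spaceWavelet S n idx) 2 (spaceMeasure d) := by
  rw [spaceMeasure_eq_pi]
  exact memLp_pi_prod
    (u := fun p : Bool × ℕ × ℤ => periodized (S.generator p.1) p.2.1 p.2.2)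
    (fun p => memLp_periodized (S.continuous_generator _) (S.hasCompactSupport_generator _) _ _) d
    fun i => (idx.1.1 i, n - 1, ((idx.2 i : ℕ) : ℤ))

theorem integral_spaceWavelet_mul_eq_prod (n m : ℕ) (idx : SpaceIdx d n) (idx' : SpaceIdx d m) :
    ∫ x, spaceWavelet S n idx x * spaceWavelet S m idx' x ∂(spaceMeasure d) =
      ∏ i, ∫ t, periodized (S.generator (idx.1.1 i)) (n - 1) ((idx.2 i : ℕ) : ℤ) t *
        periodized (S.generator (idx'.1.1 i)) (m - 1) ((idx'.2 i : ℕ) : ℤ) t ∂timeMeasure := by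
  rw [spaceMeasure_eq_pi, ← integral_fintype_prod_eq_prod]
  simp only [spaceWavelet, Finset.prod_mul_distrib]

theorem integral_spaceWavelet_mul_of_lt {n m : ℕ} (h : n < m) (idx : SpaceIdx d n)
    (idx' : SpaceIdx d m) :
    ∫ x, spaceWavelet S n idx x * spaceWavelet S m idx' x ∂(spaceMeasure d) = 0 := by
  rw [integral_spaceWavelet_mul_eq_prod]
  have hne : idx'.1.1 ≠ fun _ => false := fun h0 => by
    have := idx'.1.2.1 h0
    omega
  obtain ⟨i, hi⟩ := Function.ne_iff.1 hne
  have hi' : idx'.1.1 i = true := by simpa using hi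
  refine Finset.prod_eq_zero (Finset.mem_univ i) ?_
  rw [hi']
  -- Encoded levels `0` and `1` share the scale `0`, so the scales need not differ when `n = 0`. In
  -- that case all factors at level `n` are father wavelets, which are orthogonal to mother wavelets
  -- of the same scale too.
  rcases Nat.eq_zero_or_pos n with rfl | hn
  · have h0 : idx.1.1 i = false := congrFun (idx.1.2.2 rfl) i
    rw [h0]
    exact S.integral_periodized_φ_mul_ψ (Nat.zero_le _) _ _
  · exact S.integral_periodized_generator_mul_ψ _ (by omega) _ _

theorem integral_spaceWavelet_mul (n : ℕ) (idx idx' : SpaceIdx d n) :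
    ∫ x, spaceWavelet S n idx x * spaceWavelet S n idx' x ∂(spaceMeasure d) =
      if idx = idx' then 1 else 0 := by
  rw [integral_spaceWavelet_mul_eq_prod]
  split_ifs with h
  · subst h
    refine Finset.prod_eq_one fun i _ => ?_
    rw [S.integral_periodized_mul_self, if_pos rfl]
  · by_cases he : idx.1.1 = idx'.1.1
    · have hk : idx.2 ≠ idx'.2 := fun hk => h (Prod.ext (Subtype.ext he) hk)
      obtain ⟨i, hi⟩ := Function.ne_iff.1 hk
      refine Finset.prod_eq_zero (Finset.mem_univ i) ?_
      rw [he, S.integral_periodized_mul_self, if_neg hi]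
    · obtain ⟨i, hi⟩ := Function.ne_iff.1 he
      exact Finset.prod_eq_zero (Finset.mem_univ i)
        (S.integral_periodized_generator_mul_ne hi _ _ _)

/-- Expand each factor of scale `j + 1` into father and mother wavelets of scale `j`. The all-father
products fall under the induction hypothesis; every other product is a wavelet of encoded level `j +
1`. -/
theorem prod_periodized_φ_mem_span_spaceWavelet (j : ℕ) (k : Fin d → ℤ) :
    (fun x : Fin d → ℝ => ∏ i, periodized S.φ j (k i) (x i)) ∈ Submodule.span ℝ
      (Set.range fun i : (n : ℕ) × SpaceIdx d n => spaceWavelet S i.1 i.2) := by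
  induction j generalizing k with
  | zero =>
    choose l hl using fun i => exists_fin_periodized_eq S.φ 0 (k i)
    refine Submodule.subset_span ⟨⟨0, ⟨⟨fun _ => false, by simp⟩, l⟩⟩, ?_⟩
    ext x
    exact Finset.prod_congr rfl fun i _ => congrFun (hl i).symm (x i)
  | succ j ih =>
    refine prod_mem_of_forall_mem_span (fun g hg => ?_) (fun i => periodized S.φ (j + 1) (k i))
      fun i => S.periodized_φ_succ_mem_span j (k i)
    choose p hp using hg
    by_cases h0 : ∀ i, (p i).1 = false
    · convert ih (fun i => (p i).2) using 4 with x i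
      rw [← hp i]
      simp only [h0 i]
      rfl
    · choose l hl using fun i => exists_fin_periodized_eq (S.generator (p i).1) j (p i).2
      refine Submodule.subset_span ⟨⟨j + 1, ⟨⟨fun i => (p i).1, ?_⟩, l⟩⟩, ?_⟩
      · simp only [Nat.add_eq_zero_iff, one_ne_zero, and_false, iff_false]
        exact fun h => h0 (congrFun h)
      · ext x
        refine Finset.prod_congr rfl fun i _ => ?_
        rw [← hp i]
        exact congrFun (hl i).symm (x i)

theorem isL2Basis_spaceWavelet (d : ℕ) :
    IsL2Basis (spaceMeasure d) fun i : (n : ℕ) × SpaceIdx d n => spaceWavelet S i.1 i.2 where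
  memLp i := memLp_spaceWavelet S i.1 i.2
  integral_sq i := by rw [integral_spaceWavelet_mul, if_pos rfl]
  integral_mul := by
    rintro ⟨n, l⟩ ⟨m, l'⟩ hne
    rcases lt_trichotomy n m with h | rfl | h
    · exact integral_spaceWavelet_mul_of_lt S h l l'
    · rw [integral_spaceWavelet_mul, if_neg]
      rintro rfl
      exact hne rfl
    · simp only [mul_comm (spaceWavelet S n l _)]
      exact integral_spaceWavelet_mul_of_lt S h l' l
  total := by
    have h := S.isTotal_periodized_φ.pi (fun p => memLp_periodized S.contDiff_φ.continuous
      S.compact_φ p.1 p.2) d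
    rw [← spaceMeasure_eq_pi] at h
    refine h.of_mem_span (fun i => memLp_spaceWavelet S i.1 i.2) fun p => ?_
    -- The factors may have different scales; the sum of the scales bounds each of them and serves
    -- as a common finer one.
    refine prod_mem_of_forall_mem_span (G := Set.range (periodized S.φ (∑ i, (p i).1)))
      (fun g hg => ?_) (fun i => periodized S.φ (p i).1 (p i).2) fun i => ?_
    · choose k hk using hg
      simp only [← hk]
      exact prod_periodized_φ_mem_span_spaceWavelet S _ k
    · exact S.periodized_φ_mem_span_of_le
        (Finset.single_le_sum (f := fun i => (p i).1) (fun _ _ => Nat.zero_le _)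
          (Finset.mem_univ i)) _

theorem isL2Basis_stWavelet {τ₁ τ₂ : ℕ} (S₁ : WaveletSystem τ₁) (S₂ : WaveletSystem τ₂) (d : ℕ) :
    IsL2Basis (stMeasure d) fun i : ((m : ℕ) × TimeIdx m) × ((n : ℕ) × SpaceIdx d n) =>
      stWavelet S₁ S₂ i.2.1 i.2.2 i.1.1 i.1.2 :=
  (isL2Basis_timeWavelet S₂).prod (isL2Basis_spaceWavelet S₁ d)

end Bases

/-! ### Besov sequence norms -/

theorem le_ellNorm {p : ℝ≥0∞} (hp : 2 ≤ p) {ι : Type} (a : ι → ℝ≥0∞) (i : ι) :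
    a i ≤ ellNorm p a := by
  unfold ellNorm
  split_ifs with h
  · exact le_iSup a i
  · have hp0 : 0 < p.toReal :=
      ENNReal.toReal_pos (two_pos.trans_le hp).ne' h
    calc a i = (a i ^ p.toReal) ^ (1 / p.toReal) := by
          rw [one_div, ENNReal.rpow_rpow_inv hp0.ne']
      _ ≤ _ := ENNReal.rpow_le_rpow (ENNReal.le_tsum i) (by positivity)

theorem two_mul_toReal_inv_le_one {p : ℝ≥0∞} (hp : 2 ≤ p) : 2 * (p⁻¹).toReal ≤ 1 := by
  have h : p⁻¹ ≤ 2⁻¹ := ENNReal.inv_le_inv.2 hp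
  have h1 := ENNReal.toReal_mono (by simp) h
  rw [ENNReal.toReal_inv 2] at h1
  rw [ENNReal.toReal_ofNat] at h1
  linarith

/-- Hölder's inequality with exponent `p/2 ≥ 1` applied to the squares; for `p = ∞` each term is
bounded by the supremum. -/
theorem sum_sq_le_card_rpow_mul_ellNorm_sq {p : ℝ≥0∞} (hp : 2 ≤ p) {ι : Type} [Fintype ι]
    (a : ι → ℝ≥0∞) :
    ∑ i, a i ^ 2 ≤ (Fintype.card ι : ℝ≥0∞) ^ (1 - 2 * (p⁻¹).toReal) * ellNorm p a ^ 2 := by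
  by_cases h : p = ∞
  · subst h
    simp only [ENNReal.inv_top, ENNReal.toReal_zero, mul_zero, sub_zero, ENNReal.rpow_one]
    calc ∑ i, a i ^ 2 ≤ ∑ _i : ι, ellNorm ∞ a ^ 2 :=
          Finset.sum_le_sum fun i _ => by gcongr; exact le_ellNorm hp a i
      _ = _ := by simp
  · have hp2 : 2 ≤ p.toReal := by
      simpa using ENNReal.toReal_mono h hp
    have hp0 : 0 < p.toReal := by linarith
    have h1 := ENNReal.rpow_sum_le_const_mul_sum_rpow Finset.univ (fun i => a i ^ 2)
      (p := p.toReal / 2) (by linarith)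
    have h2 : ∀ i, (a i ^ 2) ^ (p.toReal / 2) = a i ^ p.toReal := fun i => by
      rw [← ENNReal.rpow_natCast, ← ENNReal.rpow_mul]
      congr 1
      push_cast
      ring
    simp only [h2] at h1
    have h3 := ENNReal.rpow_le_rpow h1 (z := 2 / p.toReal) (by positivity)
    rw [← ENNReal.rpow_mul, div_mul_div_cancel₀' hp0.ne', div_self two_ne_zero, ENNReal.rpow_one,
      ENNReal.mul_rpow_of_nonneg _ _ (by positivity), ← ENNReal.rpow_mul] at h3
    refine h3.trans (le_of_eq ?_)
    unfold ellNorm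
    rw [if_neg h, tsum_fintype, ← ENNReal.rpow_natCast, ← ENNReal.rpow_mul, ENNReal.toReal_inv,
      Finset.card_univ]
    congr 2
    · field_simp
    · push_cast
      ring

/-- The Hölder factor `2 ^ (δ(n+1)(1-2/p))` is matched by the squared Besov weight `2 ^ (2ns +
δn(1-2/p))`: the dimensional parts cancel up to `2 ^ δ`, leaving `2 ^ (-2ns)`. Encoded level `n + 1`
is resolution `n`, and the extra `δ` in the cardinality bound leaves room for the orientations. -/
theorem sum_sq_le_of_besovNorm_le {δ : ℕ} {s A : ℝ} {p q : ℝ≥0∞} (hp : 2 ≤ p) (hq : 2 ≤ q)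
    (hA : 0 ≤ A) {ι : ℕ → Type} [∀ n, Fintype (ι n)] {a : (n : ℕ) → ι n → ℝ}
    (h : besovNorm δ s p q a ≤ ENNReal.ofReal A) {n : ℕ}
    (hcard : Fintype.card (ι (n + 1)) ≤ 2 ^ (δ * (n + 1))) :
    ∑ i, ENNReal.ofReal (a (n + 1) i ^ 2) ≤
      ENNReal.ofReal (2 ^ δ * (2 ^ (-2 * s)) ^ n * A ^ 2) := by
  set r : ℝ := 1 - 2 * (p⁻¹).toReal with hr
  have hr0 : 0 ≤ r := by linarith [two_mul_toReal_inv_le_one hp]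
  have hr1 : r ≤ 1 := by linarith [ENNReal.toReal_nonneg (a := p⁻¹)]
  set w : ℝ := (2 : ℝ) ^ ((n : ℝ) * (s + δ * (1 / 2 - (p⁻¹).toReal))) with hw
  have hw0 : 0 < w := by positivity
  set E := ellNorm p fun i : ι (n + 1) => ‖a (n + 1) i‖ₑ with hE
  have h1 : ENNReal.ofReal w * E ≤ ENNReal.ofReal A := by
    refine le_trans ?_ h
    have h2 := le_ellNorm hq (fun n : ℕ =>
      ENNReal.ofReal ((2 : ℝ) ^ (((n : ℝ) - 1) * (s + δ * (1 / 2 - (p⁻¹).toReal)))) *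
        ellNorm p fun i : ι n => ‖a n i‖ₑ) (n + 1)
    simp only [Nat.cast_add, Nat.cast_one, add_sub_cancel_right] at h2
    exact h2
  have h2 : ∀ i, ENNReal.ofReal (a (n + 1) i ^ 2) = ‖a (n + 1) i‖ₑ ^ 2 := fun i => by
    rw [← sq_abs, ENNReal.ofReal_pow (abs_nonneg _), ← Real.enorm_eq_ofReal_abs]
  have h3 : (Fintype.card (ι (n + 1)) : ℝ≥0∞) ^ r ≤
      ENNReal.ofReal (2 ^ δ * (2 ^ (-2 * s)) ^ n) * ENNReal.ofReal w ^ 2 := by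
    rw [← ENNReal.ofReal_pow hw0.le, ← ENNReal.ofReal_mul (by positivity), ← ENNReal.ofReal_natCast,
      ENNReal.ofReal_rpow_of_nonneg (Nat.cast_nonneg _) hr0]
    refine ENNReal.ofReal_le_ofReal ?_
    have hc : (Fintype.card (ι (n + 1)) : ℝ) ≤ (2 : ℝ) ^ ((δ : ℝ) * (n + 1)) := by
      have : (Fintype.card (ι (n + 1)) : ℝ) ≤ (2 : ℝ) ^ (δ * (n + 1)) := by exact_mod_cast hcard
      rw [← Real.rpow_natCast] at this
      exact_mod_cast this
    calc (Fintype.card (ι (n + 1)) : ℝ) ^ r ≤ ((2 : ℝ) ^ ((δ : ℝ) * (n + 1))) ^ r :=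
          Real.rpow_le_rpow (Nat.cast_nonneg _) hc hr0
      _ = (2 : ℝ) ^ (δ * r + δ * n * r) := by
          rw [← Real.rpow_mul zero_le_two]
          congr 1
          ring
      _ ≤ (2 : ℝ) ^ (δ + δ * n * r) := by
          refine Real.rpow_le_rpow_of_exponent_le one_le_two ?_
          have : (δ : ℝ) * r ≤ δ := mul_le_of_le_one_right (Nat.cast_nonneg _) hr1
          linarith
      _ = 2 ^ δ * (2 ^ (-2 * s)) ^ n * w ^ 2 := by
          rw [hw, ← Real.rpow_natCast, ← Real.rpow_natCast, ← Real.rpow_natCast,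
            ← Real.rpow_mul zero_le_two, ← Real.rpow_mul zero_le_two, ← Real.rpow_add two_pos,
            ← Real.rpow_add two_pos]
          congr 1
          rw [hr]
          push_cast
          ring
  simp only [h2]
  calc ∑ i, ‖a (n + 1) i‖ₑ ^ 2 ≤ (Fintype.card (ι (n + 1)) : ℝ≥0∞) ^ r * E ^ 2 :=
        sum_sq_le_card_rpow_mul_ellNorm_sq hp _
    _ ≤ (ENNReal.ofReal (2 ^ δ * (2 ^ (-2 * s)) ^ n) * ENNReal.ofReal w ^ 2) * E ^ 2 := by gcongr
    _ = ENNReal.ofReal (2 ^ δ * (2 ^ (-2 * s)) ^ n) * (ENNReal.ofReal w * E) ^ 2 := by ring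
    _ ≤ ENNReal.ofReal (2 ^ δ * (2 ^ (-2 * s)) ^ n) * ENNReal.ofReal A ^ 2 := by gcongr
    _ = _ := by rw [← ENNReal.ofReal_pow hA, ← ENNReal.ofReal_mul (by positivity)]

/-- The constant of the bound for the tail of a Besov sequence. -/
noncomputable def tailConst (δ : ℕ) (s : ℝ) : ℝ := 2 ^ δ * (1 - 2 ^ (-2 * s))⁻¹

theorem two_rpow_neg_lt_one {s : ℝ} (hs : 0 < s) : (2 : ℝ) ^ (-2 * s) < 1 :=
  Real.rpow_lt_one_of_one_lt_of_neg one_lt_two (by linarith)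

theorem tailConst_nonneg (δ : ℕ) {s : ℝ} (hs : 0 < s) : 0 ≤ tailConst δ s := by
  have := two_rpow_neg_lt_one hs
  exact mul_nonneg (by positivity) (inv_nonneg.2 (by linarith))

/-- A geometric series of ratio `2 ^ (-2s)`. Encoded levels from `J + 2` on are resolutions from `J
+ 1` on, whence the power `J + 1`. -/
theorem tsum_sq_le_of_besovNorm_le {δ : ℕ} {s A : ℝ} (hs : 0 < s) {p q : ℝ≥0∞} (hp : 2 ≤ p)
    (hq : 2 ≤ q) (hA : 0 ≤ A) {ι : ℕ → Type} [∀ n, Fintype (ι n)] {a : (n : ℕ) → ι n → ℝ}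
    (h : besovNorm δ s p q a ≤ ENNReal.ofReal A)
    (hcard : ∀ n, Fintype.card (ι (n + 1)) ≤ 2 ^ (δ * (n + 1))) (J : ℕ) :
    (∑' i : (n : ℕ) × ι n, if i.1 < J + 2 then 0 else ENNReal.ofReal (a i.1 i.2 ^ 2)) ≤
      ENNReal.ofReal (tailConst δ s * ((2 : ℝ) ^ (J + 1)) ^ (-2 * s) * A ^ 2) := by
  have hlt := two_rpow_neg_lt_one hs
  rw [ENNReal.tsum_sigma', ← ENNReal.summable.sum_add_tsum_nat_add' (k := J + 2),
    Finset.sum_eq_zero fun n hn => ?_, zero_add]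
  · set ρ : ℝ := 2 ^ (-2 * s) with hρ
    have hρ0 : 0 < ρ := by positivity
    have hg : HasSum (fun n : ℕ => 2 ^ δ * ρ ^ (n + (J + 1)) * A ^ 2)
        (tailConst δ s * ((2 : ℝ) ^ (J + 1)) ^ (-2 * s) * A ^ 2) := by
      have h1 := ((hasSum_geometric_of_lt_one hρ0.le hlt).mul_left
        (2 ^ δ * ρ ^ (J + 1))).mul_right (A ^ 2)
      have h2 : ((2 : ℝ) ^ (J + 1)) ^ (-2 * s) = ρ ^ (J + 1) := by
        rw [hρ, ← Real.rpow_natCast, ← Real.rpow_natCast, ← Real.rpow_mul zero_le_two,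
          ← Real.rpow_mul zero_le_two, mul_comm]
      have h3 : ∀ n, 2 ^ δ * ρ ^ (n + (J + 1)) * A ^ 2 = 2 ^ δ * ρ ^ (J + 1) * ρ ^ n * A ^ 2 :=
        fun n => by ring
      simp only [h2, h3, tailConst]
      rwa [mul_right_comm (2 ^ δ) _ (ρ ^ (J + 1))]
    rw [← hg.tsum_eq, ENNReal.ofReal_tsum_of_nonneg (fun n => by positivity) hg.summable]
    refine ENNReal.tsum_le_tsum fun n => ?_
    rw [tsum_fintype]
    simp only [if_neg (show ¬ n + (J + 2) < J + 2 by omega)]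
    exact sum_sq_le_of_besovNorm_le hp hq hA h (n := n + (J + 1)) (hcard _)
  · rw [Finset.mem_range] at hn
    simp [hn]

theorem card_timeIdx_succ_le (n : ℕ) : Fintype.card (TimeIdx (n + 1)) ≤ 2 ^ (1 * (n + 1)) := by
  rw [Fintype.card_fin, one_mul]
  exact Nat.pow_le_pow_right two_pos (Nat.sub_le _ _)

theorem card_spaceIdx_le (d n : ℕ) :
    Fintype.card (SpaceIdx d n) ≤ 2 ^ d * (2 ^ (n - 1)) ^ d := by
  rw [Fintype.card_prod]
  refine Nat.mul_le_mul ((Fintype.card_subtype_le _).trans (by simp)) (by simp)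

theorem card_spaceIdx_succ_le (d n : ℕ) :
    Fintype.card (SpaceIdx d (n + 1)) ≤ 2 ^ (d * (n + 1)) := by
  refine (card_spaceIdx_le d (n + 1)).trans (le_of_eq ?_)
  rw [Nat.add_sub_cancel, ← pow_mul, ← pow_add]
  congr 1
  ring

theorem sum_range_two_pow_le {d : ℕ} (hd : 1 ≤ d) (J : ℕ) :
    ∑ n ∈ Finset.range (J + 2), ((2 : ℕ) ^ (n - 1)) ^ d ≤ 2 * (2 ^ J) ^ d := by
  induction J with
  | zero => simp [Finset.sum_range_succ]
  | succ J ih =>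
    rw [Finset.sum_range_succ]
    -- Here `d ≥ 1` enters, through `2 ≤ 2 ^ d`: the whole sum so far is at most the next term.
    have h2 : 2 * (2 ^ J) ^ d ≤ ((2 : ℕ) ^ (J + 1)) ^ d := by
      rw [pow_succ, mul_pow, mul_comm]
      exact Nat.mul_le_mul_left _ (Nat.le_self_pow (by omega) 2)
    have h3 : J + 2 - 1 = J + 1 := by omega
    rw [h3]
    omega

theorem sum_card_spaceIdx_le {d : ℕ} (hd : 1 ≤ d) (J : ℕ) :
    ∑ n ∈ Finset.range (J + 2), Fintype.card (SpaceIdx d n) ≤ 2 * (2 ^ (J + 1)) ^ d := by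
  calc ∑ n ∈ Finset.range (J + 2), Fintype.card (SpaceIdx d n)
      ≤ ∑ n ∈ Finset.range (J + 2), 2 ^ d * (2 ^ (n - 1)) ^ d :=
        Finset.sum_le_sum fun n _ => card_spaceIdx_le d n
    _ ≤ 2 ^ d * (2 * (2 ^ J) ^ d) := by
        rw [← Finset.mul_sum]
        exact Nat.mul_le_mul_left _ (sum_range_two_pow_le hd J)
    _ = _ := by
        rw [pow_succ, mul_pow]
        ring

theorem sum_card_timeIdx_le (J : ℕ) :
    ∑ n ∈ Finset.range (J + 2), Fintype.card (TimeIdx n) ≤ 2 ^ (J + 1) := by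
  have h := sum_range_two_pow_le le_rfl J
  simp only [pow_one] at h
  simp only [Fintype.card_fin]
  rw [pow_succ, mul_comm]
  exact h

/-! ### The risk of a projection estimator -/

/-- The error has coefficient `w k` at a kept index and minus the true coefficient elsewhere. Noise
and bias occupy disjoint indices, so no cross term arises, even before taking expectations. -/
theorem IsL2Basis.lintegral_sq_projection_sub {α ι : Type*} [MeasurableSpace α]
    {μ : Measure α} {e : ι → α → ℝ} (h : IsL2Basis μ e) {f : α → ℝ} (hf : MemLp f 2 μ)
    (F : Finset ι) [DecidablePred (· ∈ F)] (w : ι → ℝ) :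
    ∫⁻ z, ENNReal.ofReal
        ((∑ i ∈ F, ((∫ x, f x * e i x ∂μ) + w i) * e i z - f z) ^ 2) ∂μ =
      ∑ i ∈ F, ENNReal.ofReal (w i ^ 2) +
        ∑' i, if i ∈ F then 0 else ENNReal.ofReal ((∫ x, f x * e i x ∂μ) ^ 2) := by
  set c : ι → ℝ := fun i => ∫ x, f x * e i x ∂μ with hc
  have hg : MemLp (fun z => ∑ i ∈ F, (c i + w i) * e i z) 2 μ :=
    memLp_finsetSum _ fun i _ => (h.memLp i).const_mul _
  have hcoef : ∀ k, ∫ z, (∑ i ∈ F, (c i + w i) * e i z - f z) * e k z ∂μ =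
      if k ∈ F then w k else - c k := by
    intro k
    simp only [sub_mul]
    rw [integral_sub (integrable_mul_of_memLp hg (h.memLp k))
      (integrable_mul_of_memLp hf (h.memLp k))]
    simp only [Finset.sum_mul, mul_assoc]
    rw [integral_finsetSum _ fun i _ =>
      (integrable_mul_of_memLp (h.memLp i) (h.memLp k)).const_mul _]
    simp only [integral_const_mul]
    split_ifs with hk
    · rw [Finset.sum_eq_single_of_mem k hk fun i _ hi => by
        rw [h.integral_mul i k hi, mul_zero], h.integral_sq]
      simp [hc]
    · rw [Finset.sum_eq_zero fun i hi => by
        rw [h.integral_mul i k (by rintro rfl; exact hk hi), mul_zero]]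
      simp [hc]
  refine (h.lintegral_sq (hg.sub hf)).trans ?_
  have hF : ∑ i ∈ F, ENNReal.ofReal (w i ^ 2) =
      ∑' i, if i ∈ F then ENNReal.ofReal (w i ^ 2) else 0 := by
    rw [tsum_eq_sum (s := F) fun i hi => if_neg hi]
    exact Finset.sum_congr rfl fun i hi => (if_pos hi).symm
  rw [hF, ← ENNReal.tsum_add]
  refine tsum_congr fun k => ?_
  simp only [Pi.sub_apply]
  rw [hcoef k]
  split_ifs <;> simp [hc]

theorem IsWhiteNoise.lintegral_sq {d : ℕ} {Ω : Type*} [MeasurableSpace Ω] {P : Measure Ω}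
    {W : (ℝ × (Fin d → ℝ) → ℝ) → Ω → ℝ} (hW : IsWhiteNoise P W) {g : ℝ × (Fin d → ℝ) → ℝ}
    (hg : MemLp g 2 (stMeasure d)) (h1 : ∫ z, g z * g z ∂(stMeasure d) = 1) :
    AEMeasurable (fun ω => ENNReal.ofReal (W g ω ^ 2)) P ∧
      ∫⁻ ω, ENNReal.ofReal (W g ω ^ 2) ∂P = 1 := by
  have h2 := hW.covariance g g hg hg
  rw [h1] at h2
  simp only [← sq] at h2
  -- A nonzero Bochner integral forces integrability.
  have hi : Integrable (fun ω => W g ω ^ 2) P :=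
    Integrable.of_integral_ne_zero (by rw [h2]; exact one_ne_zero)
  refine ⟨hi.aemeasurable.ennreal_ofReal, ?_⟩
  rw [← ofReal_integral_eq_lintegral_ofReal hi (ae_of_all _ fun _ => sq_nonneg _), h2,
    ENNReal.ofReal_one]

section Risk

variable {τ₁ τ₂ : ℕ} (S₁ : WaveletSystem τ₁) (S₂ : WaveletSystem τ₂) {d : ℕ}

/-- The indices of the wavelets kept by the projection estimator. -/
def keptIndices (d j₁ m₂ : ℕ) : Finset (((m : ℕ) × TimeIdx m) × ((n : ℕ) × SpaceIdx d n)) :=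
  ((Finset.range (m₂ + 2)).sigma fun _ => Finset.univ) ×ˢ
    ((Finset.range (j₁ + 2)).sigma fun _ => Finset.univ)

theorem mem_keptIndices {j₁ m₂ : ℕ} {i : ((m : ℕ) × TimeIdx m) × ((n : ℕ) × SpaceIdx d n)} :
    i ∈ keptIndices d j₁ m₂ ↔ i.1.1 < m₂ + 2 ∧ i.2.1 < j₁ + 2 := by
  simp [keptIndices]

theorem card_keptIndices_le (hd : 1 ≤ d) (j₁ m₂ : ℕ) :
    (keptIndices d j₁ m₂).card ≤ 2 ^ (m₂ + 1) * (2 * (2 ^ (j₁ + 1)) ^ d) := by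
  rw [keptIndices, Finset.card_product, Finset.card_sigma, Finset.card_sigma]
  exact Nat.mul_le_mul (sum_card_timeIdx_le m₂) (sum_card_spaceIdx_le hd j₁)

theorem linearEstimator_eq_sum (j₁ m₂ : ℕ) (Y : (ℝ × (Fin d → ℝ) → ℝ) → ℝ)
    (z : ℝ × (Fin d → ℝ)) :
    linearEstimator S₁ S₂ j₁ m₂ Y z = ∑ i ∈ keptIndices d j₁ m₂,
      Y (stWavelet S₁ S₂ i.2.1 i.2.2 i.1.1 i.1.2) * stWavelet S₁ S₂ i.2.1 i.2.2 i.1.1 i.1.2 z := by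
  rw [linearEstimator, keptIndices, Finset.sum_product_right, Finset.sum_sigma]
  simp only [Finset.sum_sigma]

open Classical in
-- The projection identity holds for every outcome `ω`, and its bias part is deterministic. In
-- expectation each kept coefficient contributes `ε²`, since the basis functions have unit norm.
theorem linearRisk_eq {Ω : Type*} [MeasurableSpace Ω] {P : Measure Ω} [IsProbabilityMeasure P]
    {W : (ℝ × (Fin d → ℝ) → ℝ) → Ω → ℝ} (hW : IsWhiteNoise P W) (ε : ℝ) (j₁ m₂ : ℕ)
    {f : ℝ → (Fin d → ℝ) → ℝ}
    (hf : MemLp (fun z : ℝ × (Fin d → ℝ) => f z.1 z.2) 2 (stMeasure d)) :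
    linearRisk S₁ S₂ P W ε j₁ m₂ f =
      ENNReal.ofReal ((keptIndices d j₁ m₂).card * ε ^ 2) +
        ∑' i : ((m : ℕ) × TimeIdx m) × ((n : ℕ) × SpaceIdx d n),
          if i ∈ keptIndices d j₁ m₂ then 0
          else ENNReal.ofReal (stCoeff S₁ S₂ f i.2.1 i.2.2 i.1.1 i.1.2 ^ 2) := by
  have hb := isL2Basis_stWavelet S₁ S₂ d
  have key : ∀ ω, ∫⁻ z, ENNReal.ofReal
      ((linearEstimator S₁ S₂ j₁ m₂ (fun g => observation W ε f g ω) z - f z.1 z.2) ^ 2)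
        ∂(stMeasure d) =
      ∑ i ∈ keptIndices d j₁ m₂, ENNReal.ofReal (ε ^ 2) *
        ENNReal.ofReal (W (stWavelet S₁ S₂ i.2.1 i.2.2 i.1.1 i.1.2) ω ^ 2) +
      ∑' i : ((m : ℕ) × TimeIdx m) × ((n : ℕ) × SpaceIdx d n),
          if i ∈ keptIndices d j₁ m₂ then 0
          else ENNReal.ofReal (stCoeff S₁ S₂ f i.2.1 i.2.2 i.1.1 i.1.2 ^ 2) := by
    intro ω
    have h := hb.lintegral_sq_projection_sub hf (keptIndices d j₁ m₂)
      fun i => ε * W (stWavelet S₁ S₂ i.2.1 i.2.2 i.1.1 i.1.2) ω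
    simp only [mul_pow, ENNReal.ofReal_mul (sq_nonneg ε)] at h
    refine Eq.trans ?_ h
    simp only [linearEstimator_eq_sum, observation, mul_comm (stWavelet S₁ S₂ _ _ _ _ _) (f _ _)]
  have hw := fun i => hW.lintegral_sq (hb.memLp i) (hb.integral_sq i)
  rw [linearRisk]
  simp only [key]
  rw [lintegral_add_right _ measurable_const, lintegral_const, measure_univ, mul_one,
    lintegral_finsetSum' _ fun i _ => (hw i).1.const_mul _]
  congr 1
  rw [Finset.sum_congr rfl fun i _ => by
    rw [lintegral_const_mul'' _ (hw i).1, (hw i).2, mul_one], Finset.sum_const, nsmul_eq_mul,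
    ENNReal.ofReal_mul (Nat.cast_nonneg _), ENNReal.ofReal_natCast]

variable {S₁ S₂}

/-- By Fubini, `stCoeff` is the time-wavelet coefficient of `t ↦ ⟨f(t, ·), ψ_λ⟩`; the identity is
then Parseval in time. -/
theorem lintegral_sq_spaceCoeff {f : ℝ → (Fin d → ℝ) → ℝ}
    (hf : MemLp (fun z : ℝ × (Fin d → ℝ) => f z.1 z.2) 2 (stMeasure d)) (n : ℕ)
    (idx : SpaceIdx d n) :
    MemLp (fun t => spaceCoeff S₁ (f t) n idx) 2 timeMeasure ∧
      ∑' i : (m : ℕ) × TimeIdx m, ENNReal.ofReal (stCoeff S₁ S₂ f n idx i.1 i.2 ^ 2) =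
        ∫⁻ t, ENNReal.ofReal (spaceCoeff S₁ (f t) n idx ^ 2) ∂timeMeasure := by
  have hm : MemLp (fun t => spaceCoeff S₁ (f t) n idx) 2 timeMeasure :=
    memLp_integral_mul hf (memLp_spaceWavelet S₁ n idx)
  refine ⟨hm, ?_⟩
  rw [(isL2Basis_timeWavelet S₂).lintegral_sq hm]
  refine tsum_congr fun i => ?_
  have h := integral_mul_prod_mul (integrable_mul_of_memLp hf
    (memLp_prod_mul (memLp_timeWavelet S₂ i.1 i.2) (memLp_spaceWavelet S₁ n idx)))
  congr 2

/-- Summing over the time indices first yields time integrals of squared space coefficients. Tonelli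
moves the sum over `λ` inside, where the Besov tail bound holds for each `t` with the same radius.
-/
theorem tsum_space_tail_le {s : ℝ} (hs : 0 < s) {p q : ℝ≥0∞} (hp : 2 ≤ p) (hq : 2 ≤ q) {A : ℝ}
    (hA : 0 ≤ A) {f : ℝ → (Fin d → ℝ) → ℝ}
    (hf : MemLp (fun z : ℝ × (Fin d → ℝ) => f z.1 z.2) 2 (stMeasure d))
    (hB : (⨆ t ∈ Set.Icc (0 : ℝ) 1, besovNorm d s p q (spaceCoeff S₁ (f t))) ≤ ENNReal.ofReal A)
    (J : ℕ) :
    (∑' i : ((m : ℕ) × TimeIdx m) × ((n : ℕ) × SpaceIdx d n), if i.2.1 < J + 2 then 0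
      else ENNReal.ofReal (stCoeff S₁ S₂ f i.2.1 i.2.2 i.1.1 i.1.2 ^ 2)) ≤
      ENNReal.ofReal (tailConst d s * ((2 : ℝ) ^ (J + 1)) ^ (-2 * s) * A ^ 2) := by
  rw [ENNReal.tsum_prod', ENNReal.tsum_comm]
  calc ∑' (i : (n : ℕ) × SpaceIdx d n) (k : (m : ℕ) × TimeIdx m), (if i.1 < J + 2 then 0
        else ENNReal.ofReal (stCoeff S₁ S₂ f i.1 i.2 k.1 k.2 ^ 2))
      = ∑' i : (n : ℕ) × SpaceIdx d n, ∫⁻ t, (if i.1 < J + 2 then 0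
        else ENNReal.ofReal (spaceCoeff S₁ (f t) i.1 i.2 ^ 2)) ∂timeMeasure := by
        refine tsum_congr fun i => ?_
        split_ifs
        · simp
        · exact (lintegral_sq_spaceCoeff hf i.1 i.2).2
    _ = ∫⁻ t, ∑' i : (n : ℕ) × SpaceIdx d n, (if i.1 < J + 2 then 0
        else ENNReal.ofReal (spaceCoeff S₁ (f t) i.1 i.2 ^ 2)) ∂timeMeasure := by
        refine (lintegral_tsum fun i => ?_).symm
        split_ifs
        · exact aemeasurable_const
        · exact ((lintegral_sq_spaceCoeff (S₂ := S₂) hf i.1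
            i.2).1.aestronglyMeasurable.aemeasurable.pow_const 2).ennreal_ofReal
    _ ≤ ∫⁻ _t, ENNReal.ofReal (tailConst d s * ((2 : ℝ) ^ (J + 1)) ^ (-2 * s) * A ^ 2)
          ∂timeMeasure := by
        refine lintegral_mono_ae ?_
        filter_upwards [ae_restrict_mem (measurableSet_Icc (a := (0 : ℝ)) (b := 1))] with t ht
        exact tsum_sq_le_of_besovNorm_le hs hp hq hA ((le_iSup₂ (f := fun t _ =>
          besovNorm d s p q (spaceCoeff S₁ (f t))) t ht).trans hB) (card_spaceIdx_succ_le d) J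
    _ = _ := by rw [lintegral_const, measure_univ, mul_one]

/-- For each `λ` the Besov tail bound gives a common factor times `A_λ²`, and the squared radii are
summable. Thus only `A₂` enters the bound. -/
theorem tsum_time_tail_le {s : ℝ} (hs : 0 < s) {p q : ℝ≥0∞} (hp : 2 ≤ p) (hq : 2 ≤ q) {A : ℝ}
    {Arad : (n : ℕ) → SpaceIdx d n → ℝ} (hArad : AdmissibleRadii A Arad)
    {f : ℝ → (Fin d → ℝ) → ℝ}
    (hB : ∀ (n : ℕ) (idx : SpaceIdx d n),
      besovNorm 1 s p q (stCoeff S₁ S₂ f n idx) ≤ ENNReal.ofReal (Arad n idx)) (J : ℕ) :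
    (∑' i : ((m : ℕ) × TimeIdx m) × ((n : ℕ) × SpaceIdx d n), if i.1.1 < J + 2 then 0
      else ENNReal.ofReal (stCoeff S₁ S₂ f i.2.1 i.2.2 i.1.1 i.1.2 ^ 2)) ≤
      ENNReal.ofReal (tailConst 1 s * ((2 : ℝ) ^ (J + 1)) ^ (-2 * s) * A ^ 2) := by
  have hK : 0 ≤ tailConst 1 s * ((2 : ℝ) ^ (J + 1)) ^ (-2 * s) :=
    mul_nonneg (tailConst_nonneg 1 hs) (by positivity)
  rw [ENNReal.tsum_prod', ENNReal.tsum_comm]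
  calc ∑' (i : (n : ℕ) × SpaceIdx d n) (k : (m : ℕ) × TimeIdx m), (if k.1 < J + 2 then 0
        else ENNReal.ofReal (stCoeff S₁ S₂ f i.1 i.2 k.1 k.2 ^ 2))
      ≤ ∑' i : (n : ℕ) × SpaceIdx d n,
          ENNReal.ofReal (tailConst 1 s * ((2 : ℝ) ^ (J + 1)) ^ (-2 * s)) *
            ENNReal.ofReal (Arad i.1 i.2 ^ 2) := by
        refine ENNReal.tsum_le_tsum fun i => ?_
        rw [← ENNReal.ofReal_mul hK]
        exact tsum_sq_le_of_besovNorm_le hs hp hq (hArad.1 i.1 i.2).le (hB i.1 i.2)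
          card_timeIdx_succ_le J
    _ ≤ ENNReal.ofReal (tailConst 1 s * ((2 : ℝ) ^ (J + 1)) ^ (-2 * s)) *
          ENNReal.ofReal (A ^ 2) := by
        rw [ENNReal.tsum_mul_left, ENNReal.tsum_sigma']
        simp only [tsum_fintype]
        gcongr
        exact hArad.2
    _ = _ := (ENNReal.ofReal_mul hK).symm

theorem linearRisk_le (hd : 1 ≤ d) {A₁ A₂ : ℝ} (hA₁ : 0 ≤ A₁) {s₁ s₂ : ℝ} (hs₁ : 0 < s₁)
    (hs₂ : 0 < s₂) {p₁ q₁ p₂ q₂ : ℝ≥0∞} (hp₁ : 2 ≤ p₁) (hq₁ : 2 ≤ q₁) (hp₂ : 2 ≤ p₂)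
    (hq₂ : 2 ≤ q₂) {Arad : (n : ℕ) → SpaceIdx d n → ℝ} (hArad : AdmissibleRadii A₂ Arad)
    {Ω : Type*} [MeasurableSpace Ω] {P : Measure Ω} [IsProbabilityMeasure P]
    {W : (ℝ × (Fin d → ℝ) → ℝ) → Ω → ℝ} (hW : IsWhiteNoise P W) (ε : ℝ) (j₁ m₂ : ℕ)
    {f : ℝ → (Fin d → ℝ) → ℝ} (hf : f ∈ stBall S₁ S₂ d s₁ s₂ p₁ q₁ p₂ q₂ A₁ Arad) :
    linearRisk S₁ S₂ P W ε j₁ m₂ f ≤ ENNReal.ofReal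
      (2 ^ (m₂ + 1) * (2 * (2 ^ (j₁ + 1)) ^ d) * ε ^ 2 +
        (tailConst d s₁ * ((2 : ℝ) ^ (j₁ + 1)) ^ (-2 * s₁) * A₁ ^ 2 +
          tailConst 1 s₂ * ((2 : ℝ) ^ (m₂ + 1)) ^ (-2 * s₂) * A₂ ^ 2)) := by
  obtain ⟨hf2, -, hsup, hrad⟩ := hf
  have hK₁ : 0 ≤ tailConst d s₁ * ((2 : ℝ) ^ (j₁ + 1)) ^ (-2 * s₁) * A₁ ^ 2 :=
    mul_nonneg (mul_nonneg (tailConst_nonneg d hs₁) (by positivity)) (sq_nonneg _)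
  have hK₂ : 0 ≤ tailConst 1 s₂ * ((2 : ℝ) ^ (m₂ + 1)) ^ (-2 * s₂) * A₂ ^ 2 :=
    mul_nonneg (mul_nonneg (tailConst_nonneg 1 hs₂) (by positivity)) (sq_nonneg _)
  rw [linearRisk_eq S₁ S₂ hW ε j₁ m₂ hf2, ENNReal.ofReal_add (by positivity) (add_nonneg hK₁ hK₂),
    ENNReal.ofReal_add hK₁ hK₂]
  refine add_le_add (ENNReal.ofReal_le_ofReal ?_) ?_
  · gcongr
    exact_mod_cast card_keptIndices_le hd j₁ m₂
  -- An index left out belongs to at least one of the two tails; an index in both is counted twice,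
  -- which only enlarges the bound.
  · refine le_trans ?_ (add_le_add (tsum_space_tail_le (S₂ := S₂) hs₁ hp₁ hq₁ hA₁ hf2 hsup j₁)
      (tsum_time_tail_le hs₂ hp₂ hq₂ hArad hrad m₂))
    rw [← ENNReal.tsum_add]
    refine ENNReal.tsum_le_tsum fun i => ?_
    by_cases h1 : i.1.1 < m₂ + 2 <;> by_cases h2 : i.2.1 < j₁ + 2 <;>
      simp [mem_keptIndices, h1, h2]

end Risk

/-! ### Balancing variance and bias. -/

theorem rpow_neg_two_mul_le {κ ε X u v : ℝ} (hκ : 1 ≤ κ) (hε : 0 < ε) (hu : 0 < u)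
    (hX : κ⁻¹ * ε ^ (-(v / u)) ≤ X) : X ^ (-2 * u) ≤ κ ^ (2 * u) * ε ^ (2 * v) := by
  have hκ0 : 0 < κ := by linarith
  have h0 : 0 < κ⁻¹ * ε ^ (-(v / u)) := by positivity
  refine (Real.rpow_le_rpow_of_nonpos h0 hX (by linarith)).trans (le_of_eq ?_)
  rw [Real.mul_rpow (by positivity) (by positivity), ← Real.rpow_mul hε.le,
    Real.inv_rpow hκ0.le, ← Real.rpow_neg hκ0.le]
  congr 2
  · ring
  · field_simp

end SpatioTemporal

/-- Upper bound for the `L²`-risk of the linear wavelet projection estimator. The levels are the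
ones with `2 ^ (j₁ + 1) ≍ ε ^ (-2s/((2s+d+1)s₁))` and `2 ^ (m₂ + 1) ≍ ε ^ (-2s/((2s+d+1)s₂))`, up
to a factor `κ`; the constant `C` does not depend on `ε`, the levels, the radii `A_λ` or `f`. -/
theorem theorem2 {τ₁ τ₂ : ℕ} (S₁ : SpatioTemporal.WaveletSystem τ₁)
    (S₂ : SpatioTemporal.WaveletSystem τ₂)
    (d : ℕ) (hd : 1 ≤ d) (A₁ A₂ : ℝ) (hA₁ : 0 < A₁) (hA₂ : 0 < A₂)
    (s₁ s₂ : ℝ) (hs₁ : 0 < s₁) (hs₁τ : s₁ < τ₁) (hs₂ : 0 < s₂) (hs₂τ : s₂ < τ₂)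
    (p₁ q₁ p₂ q₂ : ℝ≥0∞) (hp₁ : 2 ≤ p₁) (hq₁ : 2 ≤ q₁) (hp₂ : 2 ≤ p₂) (hq₂ : 2 ≤ q₂)
    (s : ℝ) (hs : 0 < s) (hs_eq : 1 / s = 1 / ((d : ℝ) + 1) * (d / s₁ + 1 / s₂))
    (κ : ℝ) (hκ : 1 ≤ κ) :
    ∃ C : ℝ, 0 < C ∧ ∃ ε₀ : ℝ, 0 < ε₀ ∧
      ∀ Arad : (n : ℕ) → SpatioTemporal.SpaceIdx d n → ℝ,
      SpatioTemporal.AdmissibleRadii A₂ Arad →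
      ∀ ε : ℝ, 0 < ε → ε < ε₀ →
      ∀ j₁ m₂ : ℕ,
      κ⁻¹ * ε ^ (-(2 * s / ((2 * s + d + 1) * s₁))) ≤ (2 : ℝ) ^ (j₁ + 1) →
      (2 : ℝ) ^ (j₁ + 1) ≤ κ * ε ^ (-(2 * s / ((2 * s + d + 1) * s₁))) →
      κ⁻¹ * ε ^ (-(2 * s / ((2 * s + d + 1) * s₂))) ≤ (2 : ℝ) ^ (m₂ + 1) →
      (2 : ℝ) ^ (m₂ + 1) ≤ κ * ε ^ (-(2 * s / ((2 * s + d + 1) * s₂))) →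
      ∀ (Ω : Type*) [MeasurableSpace Ω] (P : Measure Ω) [IsProbabilityMeasure P]
        (W : (ℝ × (Fin d → ℝ) → ℝ) → Ω → ℝ), SpatioTemporal.IsWhiteNoise P W →
      (⨆ f ∈ SpatioTemporal.stBall S₁ S₂ d s₁ s₂ p₁ q₁ p₂ q₂ A₁ Arad,
        SpatioTemporal.linearRisk S₁ S₂ P W ε j₁ m₂ f) ≤
        ENNReal.ofReal (C * ε ^ (4 * s / (2 * s + d + 1))) := by
  have hκ0 : 0 < κ := by linarith
  set D : ℝ := 2 * s + d + 1 with hD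
  have hD0 : 0 < D := by positivity
  -- With this `v` the level sizes are `ε ^ (-(v / s₁))` and `ε ^ (-(v / s₂))`, and the target rate
  -- is `ε ^ (2 * v)`.
  set v : ℝ := 2 * s / D with hv
  have hv₁ : 2 * s / (D * s₁) = v / s₁ := by rw [hv, div_div]
  have hv₂ : 2 * s / (D * s₂) = v / s₂ := by rw [hv, div_div]
  have h2v : 4 * s / D = 2 * v := by rw [hv]; ring
  -- The balance of variance against bias: by the relation defining `s`, the left side is `v * (d +
  -- 1) / s = 2 * (d + 1) / D`.
  have hexp : v / s₂ + v / s₁ * d = 2 - 2 * v := by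
    have h1 : v / s₂ + v / s₁ * d = v * (d / s₁ + 1 / s₂) := by ring
    have h2 : (d : ℝ) / s₁ + 1 / s₂ = (d + 1) / s := by
      have h3 : (d : ℝ) + 1 ≠ 0 := by positivity
      rw [div_eq_mul_one_div ((d : ℝ) + 1) s, hs_eq, ← mul_assoc, mul_one_div_cancel h3, one_mul]
    rw [h1, h2, hv]
    field_simp
    rw [hD]
    ring
  rw [hv₁, hv₂, h2v]
  have hK₁ := SpatioTemporal.tailConst_nonneg d hs₁
  have hK₂ := SpatioTemporal.tailConst_nonneg 1 hs₂
  -- The three summands of `C` come from the variance, the space tail and the time tail, in this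
  -- order.
  refine ⟨2 * κ * κ ^ d + SpatioTemporal.tailConst d s₁ * κ ^ (2 * s₁) * A₁ ^ 2 +
    SpatioTemporal.tailConst 1 s₂ * κ ^ (2 * s₂) * A₂ ^ 2, by positivity, 1, one_pos, ?_⟩
  intro Arad hArad ε hε _ j₁ m₂ hj₁ hj₁' hm₂ hm₂' Ω _ P _ W hW
  refine iSup₂_le fun f hf => ?_
  refine (SpatioTemporal.linearRisk_le hd hA₁.le hs₁ hs₂ hp₁ hq₁ hp₂ hq₂ hArad hW ε j₁ m₂
    hf).trans (ENNReal.ofReal_le_ofReal ?_)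
  have hb₁ := SpatioTemporal.rpow_neg_two_mul_le hκ hε hs₁ hj₁
  have hb₂ := SpatioTemporal.rpow_neg_two_mul_le hκ hε hs₂ hm₂
  have hvar : (2 : ℝ) ^ (m₂ + 1) * (2 * (2 ^ (j₁ + 1)) ^ d) * ε ^ 2 ≤
      2 * κ * κ ^ d * ε ^ (2 * v) := by
    calc (2 : ℝ) ^ (m₂ + 1) * (2 * (2 ^ (j₁ + 1)) ^ d) * ε ^ 2
        ≤ (κ * ε ^ (-(v / s₂))) * (2 * (κ * ε ^ (-(v / s₁))) ^ d) * ε ^ 2 := by gcongr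
      _ = 2 * κ * κ ^ d * (ε ^ (-(v / s₂)) * (ε ^ (-(v / s₁))) ^ d * ε ^ 2) := by ring
      _ = 2 * κ * κ ^ d * ε ^ (2 * v) := by
          rw [← Real.rpow_natCast (ε ^ _) d, ← Real.rpow_natCast ε 2, ← Real.rpow_mul hε.le,
            ← Real.rpow_add hε, ← Real.rpow_add hε]
          congr 2
          push_cast
          linarith
  have hb₁' := mul_le_mul_of_nonneg_right (mul_le_mul_of_nonneg_left hb₁ hK₁) (sq_nonneg A₁)
  have hb₂' := mul_le_mul_of_nonneg_right (mul_le_mul_of_nonneg_left hb₂ hK₂) (sq_nonneg A₂)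
  linarith
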